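/- Let $\mathcal{K}$ be a chiral abstract $n$-polytope of type $\{p_1,\dots,p_{n-1}\}$, where $p_i\in\{2,3,\dots,\infty\}$. Here a polytope is chiral if it is rotary (its rotation group, i.e. the group of automorphisms preserving the set of white flags, is transitive on white flags) but its automorphism group is not transitive on all flags. Assume that $\mathcal{K}$ covers a regular $n$-maniplex $\mathcal{R}$ with at least two facets, i.e. there is a surjective colour-preserving map from the flag graph of $\mathcal{K}$ onto $\mathcal{R}$. Let $\mathcal{P}$ be a chiral extension of $\mathcal{K}$ (a chiral $(n+1)$-polytope all of whose facets are isomorphic to $\mathcal{K}$) of type $\{p_1,\dots,p_{n-1},q\}$, $q\in\{2,3,\dots,\infty\}$. Then for every integer $s\ge 1$, $\mathcal{K}$ has a chiral extension $\mathcal{Q}$ of type $\{p_1,\dots,p_{n-1},\operatorname{lcm}(q,2s)\}$, where $\operatorname{lcm}(\infty,2s)=\infty$. Moreover, fix any base flags $\Phi_0$ of $\mathcal{P}$ and $x_0$ of $\mathcal{R}$. Then $\mathcal{Q}$ and a base flag of it can be chosen so that the rotation group of $\mathcal{Q}$ is the mix of the rotation groups of $\mathcal{P}$ and of $2s^{\mathcal{R}-1}$.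 That is, there is an isomorphism $$\operatorname{Aut}^+(\mathcal{Q})\;\cong\;\langle(\sigma_1,\sigma_1'),\dots,(\sigma_n,\sigma_n')\rangle\le \operatorname{Aut}^+(\mathcal{P})\times\operatorname{Aut}^+(2s^{\mathcal{R}-1})$$ which sends the $i$-th abstract rotation of $\mathcal{Q}$ to $(\sigma_i,\sigma_i')$, where $\sigma_i$ and $\sigma'_i$ are the abstract rotations with respect to the base flags (the $i$-th abstract rotation is the automorphism that sends the base flag $\Phi$ to $(\Phi^{i})^{i-1}$, the $(i-1)$-adjacent flag of the $i$-adjacent flag of $\Phi$). The $(n+1)$-maniplex $2s^{\mathcal{R}-1}$ is defined as follows. Let $U$ be the group of finitely supported $\mathbb{Z}/s$-valued vectors with sum zero that are indexed by the facets of $\mathcal{R}$. Let $e_j$ be the standard unit vectors, let $a_j=e_j-e_0$, where $0$ denotes the facet containing $x_0$, and let $r_0,\dots,r_{n-1}$ be the adjacency permutations of the flags of $\mathcal{R}$. The flags of $2s^{\mathcal{R}-1}$ are the triples $(x,v,\delta)$ with $x$ a flag of $\mathcal{R}$, $v\in U$ and $\delta\in\{0,1\}$. The adjacency permutations are $\hat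 r_i(x,v,\delta)=(r_ix,v,\delta)$ for $0\le i\le n-1$ and $\hat r_n(x,v,\delta)=(x,v+(-1)^\delta a_j,1-\delta)$, where $j$ is the facet containing $x$. The base flag is $(x_0,0,0)$. -/

import Mathlib

universe u

noncomputable section

/-! ### Abstract polytopes -/

/-- The rank of a face: the length of a longest chain of faces ending in it, minus one.  When all
flags of a bounded poset have `n + 2` elements, the least face has rank `-1`, the greatest has rank
`n`, and any other face `F` has as rank the number of faces strictly between the least face and
`F` in any flag through `F`. -/
def faceRank {α : Type u} [PartialOrder α] (F : α) : ℤ :=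
  ((Order.height F).toNat : ℤ) - 1

/-- Two flags (maximal chains) are `i`-adjacent if they differ exactly in the face of rank `i`. -/
def FlagAdj {α : Type u} [PartialOrder α] (i : ℤ) (Φ Ψ : Flag α) : Prop :=
  Φ ≠ Ψ ∧ ∀ F : α, faceRank F ≠ i → (F ∈ Φ ↔ F ∈ Ψ)

/-- `α` is an abstract polytope of rank `n`. -/
structure IsPolytope (n : ℕ) (α : Type u) [PartialOrder α] [BoundedOrder α] : Prop where
  flag_card : ∀ Φ : Flag α, (Φ : Set α).ncard = n + 2
  diamond : ∀ i : ℕ, i < n → ∀ F H : α, faceRank F = (i : ℤ) - 1 → faceRank H = (i : ℤ) + 1 →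
    F ≤ H → {G : α | F < G ∧ G < H}.ncard = 2
  strongly_flag_connected : ∀ Φ Ψ : Flag α,
    Relation.ReflTransGen
      (fun A B : Flag α => (∃ i : ℤ, FlagAdj i A B) ∧ (Φ : Set α) ∩ Ψ ⊆ B) Φ Ψ

/-- The polytope `α` of rank `n` is of type `{p 1, …, p (n - 1)}`: for each `i` with
`1 ≤ i ≤ n - 1` every section `G / F` of rank 2, with `F` of rank `i - 2` and `G` of rank `i + 1`,
is a `p i`-gon, that is, it has exactly `p i` vertices.
Values of `p` outside `1, …, n - 1` play no role. -/
def HasSchlafliType (n : ℕ) (α : Type u) [PartialOrder α] (p : ℕ → ℕ∞) : Prop :=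
  ∀ i : ℕ, 1 ≤ i → i < n → ∀ F G : α,
    faceRank F = (i : ℤ) - 2 → faceRank G = (i : ℤ) + 1 → F ≤ G →
      {H : α | F ≤ H ∧ H ≤ G ∧ faceRank H = (i : ℤ) - 1}.encard = p i

/-- The polytope `P` of rank `n + 1` is an extension of `K`: each of its facets, seen as a section
`F / F₋₁`, is isomorphic to `K`. -/
def IsExtension (n : ℕ) (K P : Type u) [PartialOrder K] [PartialOrder P] : Prop :=
  ∀ F : P, faceRank F = (n : ℤ) → Nonempty (Set.Iic F ≃o K)

/-! ### Symmetries of polytopes -/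

/-- All flags are equivalent under the automorphism group. -/
def IsRegularPolytope (α : Type u) [PartialOrder α] : Prop :=
  ∀ Φ Ψ : Flag α, ∃ γ : α ≃o α, Flag.map γ Φ = Ψ

/-- A proper 2-colouring of the flag graph; the polytope is orientable if there is one. -/
def IsFlagColouring {α : Type u} [PartialOrder α] (c : Flag α → Bool) : Prop :=
  ∀ (i : ℤ) (Φ Ψ : Flag α), FlagAdj i Φ Ψ → c Φ ≠ c Ψ

/-- The white flags with respect to the base flag `Φ₀`: the flags on the same part of the flag
graph as `Φ₀` if it is bipartite, and all flags if it is not. -/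
def whiteFlags {α : Type u} [PartialOrder α] (Φ₀ : Flag α) : Set (Flag α) :=
  {Ψ | ∀ c : Flag α → Bool, IsFlagColouring c → c Ψ = c Φ₀}

/-- The rotation group: the automorphisms that permute the white flags. -/
def rotationGroup {α : Type u} [PartialOrder α] (Φ₀ : Flag α) : Subgroup (α ≃o α) where
  carrier := {γ | ∀ Ψ : Flag α, Flag.map γ Ψ ∈ whiteFlags Φ₀ ↔ Ψ ∈ whiteFlags Φ₀}
  one_mem' := by
    intro Ψ
    have h : Flag.map (1 : α ≃o α) Ψ = Ψ := by
      apply Flag.ext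
      simp
    rw [h]
  mul_mem' := by
    intro a b ha hb Ψ
    have h : Flag.map (a * b) Ψ = Flag.map a (Flag.map b Ψ) := by
      apply Flag.ext
      simp only [Flag.coe_map, Set.image_image]
      rfl
    rw [h, ha, hb]
  inv_mem' := by
    intro a ha Ψ
    have h : Flag.map a (Flag.map a⁻¹ Ψ) = Ψ := by
      apply Flag.ext
      simp only [Flag.coe_map, Set.image_image]
      simp
    rw [← ha, h]

/-- The rotation group is transitive on the white flags. -/
def IsRotaryPolytope (α : Type u) [PartialOrder α] : Prop :=
  ∀ Φ₀ : Flag α, ∀ Φ ∈ whiteFlags Φ₀, ∀ Ψ ∈ whiteFlags Φ₀,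
    ∃ γ ∈ rotationGroup Φ₀, Flag.map γ Φ = Ψ

/-- A polytope is chiral if it is rotary but not regular. -/
def IsChiralPolytope (α : Type u) [PartialOrder α] : Prop :=
  IsRotaryPolytope α ∧ ¬ IsRegularPolytope α

/-- `γ` is the abstract rotation `σ_i` with respect to the base flag `Φ₀`: it maps `Φ₀` to the
`(i - 1)`-adjacent flag of the `i`-adjacent flag of `Φ₀`. -/
def IsAbstractRotation {α : Type u} [PartialOrder α] (Φ₀ : Flag α) (i : ℕ) (γ : α ≃o α) : Prop :=
  1 ≤ i ∧ ∃ Φ₁ : Flag α, FlagAdj (i : ℤ) Φ₀ Φ₁ ∧ FlagAdj ((i : ℤ) - 1) Φ₁ (Flag.map γ Φ₀)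

/-! ### Maniplexes -/

/-- A maniplex of rank `n`: `r i x` is the flag joined to the flag `x` by the edge of colour
`i`. -/
structure Maniplex (n : ℕ) where
  Flags : Type u
  r : Fin n → Equiv.Perm Flags
  nonempty : Nonempty Flags
  involutive : ∀ i x, r i (r i x) = x
  fixed_point_free : ∀ i x, r i x ≠ x
  distinct : ∀ i j x, i ≠ j → r i x ≠ r j x
  squares : ∀ i j : Fin n, (i : ℕ) + 2 ≤ j → ∀ x, r i (r j x) = r j (r i x)
  connected : ∀ x y, ∃ g ∈ Subgroup.closure (Set.range r), g x = y

namespace Maniplex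

/-- The automorphism group: the permutations of the flags that commute with all the `r i`. -/
def aut {n : ℕ} (M : Maniplex.{u} n) : Subgroup (Equiv.Perm M.Flags) :=
  Subgroup.centralizer (Set.range M.r)

/-- A maniplex is regular if its automorphism group is transitive on flags. -/
def IsRegular {n : ℕ} (M : Maniplex.{u} n) : Prop :=
  ∀ x y : M.Flags, ∃ γ ∈ M.aut, γ x = y

/-- The group generated by the `r i` with `i ≠ n - 1`. -/
def facetGroup {n : ℕ} (M : Maniplex.{u} n) : Subgroup (Equiv.Perm M.Flags) :=
  Subgroup.closure {g | ∃ i : Fin n, (i : ℕ) + 1 < n ∧ g = M.r i}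

/-- The set of flags of the facet that contains the flag `x`. -/
def facetSet {n : ℕ} (M : Maniplex.{u} n) (x : M.Flags) : Set M.Flags :=
  {y | ∃ g ∈ M.facetGroup, g x = y}

/-- The facets: the connected components left when the edges of colour `n - 1` are removed. -/
def Facet {n : ℕ} (M : Maniplex.{u} n) : Type u :=
  {S : Set M.Flags // ∃ x, S = M.facetSet x}

/-- The facet that contains the flag `x`. -/
def facetOf {n : ℕ} (M : Maniplex.{u} n) (x : M.Flags) : M.Facet :=
  ⟨M.facetSet x, x, rfl⟩

/-- `γ` is the abstract rotation `σ_i` with respect to the base flag `x₀`. -/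
def IsAbstractRotation {n : ℕ} (M : Maniplex.{u} n) (x₀ : M.Flags) (i : ℕ) (γ : M.aut) : Prop :=
  ∃ a b : Fin n, (a : ℕ) + 1 = i ∧ (b : ℕ) = i ∧
    (γ : Equiv.Perm M.Flags) x₀ = M.r a (M.r b x₀)

end Maniplex

/-- The polytope `K` of rank `n` covers the maniplex `R`, i.e. `R` is a quotient of `K`: there is a
colour-preserving map from the flag graph of `K` onto `R`. -/
def PolytopeCovers {n : ℕ} (K : Type u) [PartialOrder K] (R : Maniplex.{u} n) : Prop :=
  ∃ φ : Flag K → R.Flags, Function.Surjective φ ∧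
    ∀ (i : Fin n) (Φ Ψ : Flag K), FlagAdj ((i : ℕ) : ℤ) Φ Ψ → φ Ψ = R.r i (φ Φ)

/-! ### The maniplex `2s^(M - 1)` -/

namespace Maniplex

/-- The finitely supported vectors indexed by the facets of `M`, with entries in `ℤ/s` and with
sum zero. -/
def vectorGroup {n : ℕ} (M : Maniplex.{u} n) (s : ℕ) : AddSubgroup (M.Facet →₀ ZMod s) :=
  (Finsupp.liftAddHom (fun _ : M.Facet => AddMonoidHom.id (ZMod s))).ker

/-- The vector `a_j = e_j - e_0`, where `0` stands for the facet of the base flag `x₀`. -/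
def facetVector {n : ℕ} (M : Maniplex.{u} n) (x₀ : M.Flags) (s : ℕ) (j : M.Facet) :
    M.vectorGroup s :=
  ⟨Finsupp.single j 1 - Finsupp.single (M.facetOf x₀) 1, by
    rw [vectorGroup, AddMonoidHom.mem_ker, map_sub, Finsupp.liftAddHom_apply_single,
      Finsupp.liftAddHom_apply_single]
    simp⟩

theorem facetOf_r {n : ℕ} (M : Maniplex.{u} n) (i : Fin n) (hi : (i : ℕ) + 1 < n) (x : M.Flags) :
    M.facetOf (M.r i x) = M.facetOf x := by
  have hmem : M.r i ∈ M.facetGroup := Subgroup.subset_closure ⟨i, hi, rfl⟩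
  apply Subtype.ext
  ext y
  constructor
  · rintro ⟨g, hg, h⟩
    exact ⟨g * M.r i, mul_mem hg hmem, h⟩
  · rintro ⟨g, hg, h⟩
    refine ⟨g * M.r i, mul_mem hg hmem, ?_⟩
    rw [Equiv.Perm.mul_apply, M.involutive]
    exact h

/-- The flags of `2s^(M - 1)`; the last coordinate is the element of `ℤ/2`, with `true` for `1`. -/
abbrev TwoSFlags {n : ℕ} (M : Maniplex.{u} n) (s : ℕ) : Type u :=
  M.Flags × M.vectorGroup s × Bool

/-- The permutation of the flags of `2s^(M - 1)` of colour `i ≤ n - 1`. -/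
def twoSLower {n : ℕ} (M : Maniplex.{u} n) (s : ℕ) (i : Fin n) :
    Equiv.Perm (M.TwoSFlags s) :=
  Function.Involutive.toPerm (fun z => (M.r i z.1, z.2)) (by
    rintro ⟨x, v, d⟩
    simp [M.involutive])

/-- The permutation of the flags of `2s^(M - 1)` of colour `n`:
`(x, v, δ) ↦ (x, v + (-1)^δ a_j, 1 - δ)`, where `j` is the facet of `x`. -/
def twoSLast {n : ℕ} (M : Maniplex.{u} n) (x₀ : M.Flags) (s : ℕ) :
    Equiv.Perm (M.TwoSFlags s) :=
  Function.Involutive.toPerm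
    (fun z => (z.1, (if z.2.2 = true then z.2.1 - M.facetVector x₀ s (M.facetOf z.1)
      else z.2.1 + M.facetVector x₀ s (M.facetOf z.1)), !z.2.2)) (by
    rintro ⟨x, v, d⟩
    cases d <;> simp)

/-- The permutations of the flags of `2s^(M - 1)` for the colours `0, …, n`. -/
def twoSPerm {n : ℕ} (M : Maniplex.{u} n) (x₀ : M.Flags) (s : ℕ) :
    Fin (n + 1) → Equiv.Perm (M.TwoSFlags s) :=
  Fin.lastCases (M.twoSLast x₀ s) (M.twoSLower s)

@[simp] theorem twoSPerm_last {n : ℕ} (M : Maniplex.{u} n) (x₀ : M.Flags) (s : ℕ) :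
    M.twoSPerm x₀ s (Fin.last n) = M.twoSLast x₀ s := by
  simp [twoSPerm]

@[simp] theorem twoSPerm_castSucc {n : ℕ} (M : Maniplex.{u} n) (x₀ : M.Flags) (s : ℕ)
    (i : Fin n) : M.twoSPerm x₀ s i.castSucc = M.twoSLower s i := by
  simp [twoSPerm]

@[simp] theorem twoSLower_apply {n : ℕ} (M : Maniplex.{u} n) (s : ℕ) (i : Fin n) (x : M.Flags)
    (v : M.vectorGroup s) (d : Bool) : M.twoSLower s i (x, v, d) = (M.r i x, v, d) := rfl

@[simp] theorem twoSLast_apply {n : ℕ} (M : Maniplex.{u} n) (x₀ : M.Flags) (s : ℕ) (x : M.Flags)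
    (v : M.vectorGroup s) (d : Bool) : M.twoSLast x₀ s (x, v, d) =
      (x, (if d = true then v - M.facetVector x₀ s (M.facetOf x)
        else v + M.facetVector x₀ s (M.facetOf x)), !d) := rfl

theorem twoS_connected {n : ℕ} (M : Maniplex.{u} n) (x₀ : M.Flags) (s : ℕ)
    (z w : M.TwoSFlags s) :
    ∃ g ∈ Subgroup.closure (Set.range (M.twoSPerm x₀ s)), g z = w := by
  set G := Subgroup.closure (Set.range (M.twoSPerm x₀ s)) with hG
  have htrans : ∀ a b c : M.TwoSFlags s, (∃ g ∈ G, g a = b) → (∃ g ∈ G, g b = c) →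
      ∃ g ∈ G, g a = c := by
    rintro a b c ⟨g, hg, rfl⟩ ⟨h, hh, rfl⟩
    exact ⟨h * g, mul_mem hh hg, rfl⟩
  have hsymm : ∀ a b : M.TwoSFlags s, (∃ g ∈ G, g a = b) → ∃ g ∈ G, g b = a := by
    rintro a b ⟨g, hg, rfl⟩
    exact ⟨g⁻¹, inv_mem hg, by simp⟩
  have hlastmem : M.twoSLast x₀ s ∈ G :=
    Subgroup.subset_closure ⟨Fin.last n, M.twoSPerm_last x₀ s⟩
  have hlift : ∀ g ∈ Subgroup.closure (Set.range M.r), ∃ h ∈ G, ∀ x v d,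
      h (x, v, d) = (g x, v, d) := by
    intro g hg
    induction hg using Subgroup.closure_induction with
    | mem g hg =>
      obtain ⟨i, rfl⟩ := hg
      exact ⟨M.twoSLower s i, Subgroup.subset_closure ⟨i.castSucc, M.twoSPerm_castSucc x₀ s i⟩,
        fun x v d => rfl⟩
    | one => exact ⟨1, one_mem _, fun x v d => rfl⟩
    | mul a b _ _ iha ihb =>
      obtain ⟨a', ha', ha⟩ := iha
      obtain ⟨b', hb', hb⟩ := ihb
      exact ⟨a' * b', mul_mem ha' hb', fun x v d => by
        rw [Equiv.Perm.mul_apply, hb, ha, Equiv.Perm.mul_apply]⟩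
    | inv a _ iha =>
      obtain ⟨a', ha', ha⟩ := iha
      refine ⟨a'⁻¹, inv_mem ha', fun x v d => ?_⟩
      rw [Equiv.Perm.inv_eq_iff_eq, ha]
      simp
  have hmove : ∀ x y v d, ∃ g ∈ G, g (x, v, d) = (y, v, d) := by
    intro x y v d
    obtain ⟨g, hg, hxy⟩ := M.connected x y
    obtain ⟨h, hh, hh2⟩ := hlift g hg
    exact ⟨h, hh, by rw [hh2, hxy]⟩
  have hflip : ∀ v, ∃ g ∈ G, g (x₀, v, false) = (x₀, v, true) := by
    intro v
    refine ⟨_, hlastmem, ?_⟩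
    have h0 : M.facetVector x₀ s (M.facetOf x₀) = 0 := by
      apply Subtype.ext
      simp [facetVector]
    simp [h0]
  have hstep : ∀ j v, ∃ g ∈ G, g (x₀, v, false) = (x₀, v + M.facetVector x₀ s j, false) := by
    rintro ⟨S, x, rfl⟩ v
    refine htrans _ _ _ (hmove x₀ x v false) ?_
    refine htrans _ (x, v + M.facetVector x₀ s (M.facetOf x), true) _
      ⟨_, hlastmem, by simp⟩ ?_
    refine htrans _ _ _ (hmove x x₀ _ true) ?_
    exact hsymm _ _ (hflip _)
  let T : AddSubgroup (M.vectorGroup s) :=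
    { carrier := {t | ∀ v, ∃ g ∈ G, g (x₀, v, false) = (x₀, v + t, false)}
      zero_mem' := fun v => ⟨1, one_mem _, by simp⟩
      add_mem' := fun {a b} ha hb v => by
        refine htrans _ _ _ (ha v) ?_
        rw [← add_assoc]
        exact hb (v + a)
      neg_mem' := fun {a} ha v => by
        apply hsymm
        have := ha (v + -a)
        rwa [neg_add_cancel_right] at this }
  have hgen : ∀ y : M.Facet →₀ ZMod s, ∃ t ∈ T, (t : M.Facet →₀ ZMod s) =
      y - Finsupp.single (M.facetOf x₀)
        (Finsupp.liftAddHom (fun _ : M.Facet => AddMonoidHom.id (ZMod s)) y) := by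
    intro y
    induction y using Finsupp.induction_linear with
    | zero => exact ⟨0, zero_mem _, by simp⟩
    | add a b iha ihb =>
      obtain ⟨t, ht, h1⟩ := iha
      obtain ⟨t', ht', h2⟩ := ihb
      refine ⟨t + t', add_mem ht ht', ?_⟩
      rw [AddSubgroup.coe_add, h1, h2, map_add, Finsupp.single_add]
      abel
    | single j c =>
      obtain ⟨k, rfl⟩ := ZMod.intCast_surjective c
      have hj : M.facetVector x₀ s j ∈ T := hstep j
      refine ⟨k • M.facetVector x₀ s j, zsmul_mem hj k, ?_⟩
      simp [facetVector, smul_sub]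
  have hbase : ∀ z : M.TwoSFlags s, ∃ g ∈ G, g (x₀, 0, false) = z := by
    rintro ⟨x, v, d⟩
    refine htrans _ (x₀, v, false) _ ?_ ?_
    · obtain ⟨t, ht, h⟩ := hgen v
      have hv : Finsupp.liftAddHom (fun _ : M.Facet => AddMonoidHom.id (ZMod s))
          (v : M.Facet →₀ ZMod s) = 0 := v.2
      rw [hv, Finsupp.single_zero, sub_zero] at h
      have htv : t = v := Subtype.ext h
      have := ht 0
      rwa [zero_add, htv] at this
    · cases d with
      | false => exact hmove _ _ _ _
      | true => exact htrans _ _ _ (hflip v) (hmove _ _ _ _)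
  exact htrans _ _ _ (hsymm _ _ (hbase z)) (hbase w)

/-- The maniplex `2s^(M - 1)` of rank `n + 1`, for a maniplex `M` of rank `n` with base flag
`x₀`. -/
def twoS {n : ℕ} (M : Maniplex.{u} n) (x₀ : M.Flags) (s : ℕ) : Maniplex.{u} (n + 1) where
  Flags := M.TwoSFlags s
  r := M.twoSPerm x₀ s
  nonempty := ⟨(x₀, 0, false)⟩
  involutive := by
    rintro i ⟨x, v, d⟩
    induction i using Fin.lastCases with
    | last => cases d <;> simp
    | cast i => simp [M.involutive]
  fixed_point_free := by
    rintro i ⟨x, v, d⟩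
    induction i using Fin.lastCases with
    | last => simp
    | cast i => simp [M.fixed_point_free]
  distinct := by
    rintro i j ⟨x, v, d⟩ hij
    induction i using Fin.lastCases with
    | last =>
      induction j using Fin.lastCases with
      | last => exact absurd rfl hij
      | cast j => simp
    | cast i =>
      induction j using Fin.lastCases with
      | last => simp
      | cast j =>
        have hne : i ≠ j := fun h => hij (by rw [h])
        simp [M.distinct i j x hne]
  squares := by
    rintro i j hij ⟨x, v, d⟩
    induction i using Fin.lastCases with
    | last =>
      have := j.isLt
      simp only [Fin.val_last] at hij
      omega
    | cast i =>
      induction j using Fin.lastCases with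
      | last =>
        have hi : (i : ℕ) + 1 < n := by
          simp only [Fin.val_last, Fin.val_castSucc] at hij
          omega
        simp [M.facetOf_r i hi]
      | cast j =>
        have hh : (i : ℕ) + 2 ≤ j := by simpa using hij
        simp [M.squares i j hh x]
  connected := M.twoS_connected x₀ s

/-- The base flag of `2s^(M - 1)`. -/
def twoSBase {n : ℕ} (M : Maniplex.{u} n) (x₀ : M.Flags) (s : ℕ) : (M.twoS x₀ s).Flags :=
  (x₀, 0, false)

end Maniplex

/-! ### Mixing, and least common multiples of entries of Schläfli symbols -/

/-- The mix of the rotation groups of a rotary polytope and a rotary maniplex: the subgroup of the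
direct product generated by the pairs of corresponding abstract rotations. -/
def rotationMix {n : ℕ} {P : Type u} [PartialOrder P] (Φ₀ : Flag P) (M : Maniplex.{u} n)
    (x₀ : M.Flags) : Subgroup ((P ≃o P) × M.aut) :=
  Subgroup.closure {g | ∃ i : ℕ, IsAbstractRotation Φ₀ i g.1 ∧ M.IsAbstractRotation x₀ i g.2}

/-- The least common multiple of `q ∈ {2, 3, …, ∞}` and a positive integer, which is `∞` if
`q = ∞`. -/
def lcmTop (q : ℕ∞) (m : ℕ) : ℕ∞ :=
  if q = ⊤ then ⊤ else ((Nat.lcm q.toNat m : ℕ) : ℕ∞)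

end

/-!
The flag graph of the mix `Q` of `P` and `2s^(R-1)` is a connected component of the product of the
two flag graphs. Along a walk that stays in a facet, the coordinate in `2s^(R-1)` moves only in `R`;
since the facets of `P` are isomorphic to `K`, which covers `R`, this motion is determined by the
coordinate in `P`. So the covering `Q → P` is injective on facets, which implies both that the
facets of `Q` are isomorphic to `K` and that `Q` inherits the path intersection property from `P`.

The white flags of `P` induce a colouring of `Q`, and pairs of corresponding rotations act on `Q`,
transitively on the white flags; hence `Q` is rotary, with the mix of the two groups as its rotation
group, and the last entry of its type is the least common multiple of `q` and the period `2s` of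
the last rotation of `2s^(R-1)`. It is not regular, as its facets would then be regular.
-/

/-- `y` can be reached from `x` by a path with colours in `I`, in the graph whose edge of colour
`i` at `x` joins `x` to `r i x`. -/
def Linked {ι X : Type*} (r : ι → Equiv.Perm X) (I : Set ι) : X → X → Prop :=
  Relation.ReflTransGen (fun a b => ∃ i ∈ I, b = r i a)

namespace Linked

variable {ι X Y : Type*} {r : ι → Equiv.Perm X} {r' : ι → Equiv.Perm Y} {I J A B : Set ι}
  {x y z : X}

theorem refl (x : X) : Linked r I x x := Relation.ReflTransGen.refl

theorem trans (h : Linked r I x y) (h' : Linked r I y z) : Linked r I x z :=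
  Relation.ReflTransGen.trans h h'

theorem step {i : ι} (hi : i ∈ I) (x : X) : Linked r I x (r i x) :=
  Relation.ReflTransGen.single ⟨i, hi, rfl⟩

theorem tail {i : ι} (h : Linked r I x y) (hi : i ∈ I) : Linked r I x (r i y) :=
  h.trans (step hi y)

theorem mono (hIJ : I ⊆ J) (h : Linked r I x y) : Linked r J x y :=
  Relation.ReflTransGen.mono (fun _ _ ⟨i, hi, e⟩ => ⟨i, hIJ hi, e⟩) _ _ h

@[elab_as_elim]
theorem induction {motive : (y : X) → Linked r I x y → Prop} (refl : motive x (refl x))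
    (tail : ∀ (y) (hy : Linked r I x y) (i) (hi : i ∈ I), motive y hy →
      motive (r i y) (hy.tail hi)) {y : X} (h : Linked r I x y) : motive y h := by
  induction h with
  | refl => exact refl
  | tail hxy hs ih =>
    obtain ⟨i, hi, rfl⟩ := hs
    exact tail _ hxy i hi ih

theorem symm (hr : ∀ i, Function.Involutive (r i)) (h : Linked r I x y) : Linked r I y x := by
  induction h using induction with
  | refl => exact refl x
  | tail y _ i hi ih =>
    have hback := step (r := r) hi (r i y)
    rw [hr] at hback
    exact hback.trans ih

theorem map (f : X → Y) (hf : ∀ i ∈ I, ∀ x, f (r i x) = r' i (f x)) (h : Linked r I x y) :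
    Linked r' I (f x) (f y) := by
  induction h using induction with
  | refl => exact refl _
  | tail y _ i hi ih => exact hf i hi y ▸ ih.tail hi

theorem lift (f : X → Y) (hf : ∀ i ∈ I, ∀ x, f (r i x) = r' i (f x)) {w : Y}
    (h : Linked r' I (f x) w) : ∃ y, Linked r I x y ∧ f y = w := by
  induction h using induction with
  | refl => exact ⟨x, refl x, rfl⟩
  | tail _ _ i hi ih =>
    obtain ⟨y, hy, rfl⟩ := ih
    exact ⟨r i y, hy.tail hi, hf i hi y⟩

theorem eq_of_invariant {β : Type*} (f : X → β) (hf : ∀ i ∈ I, ∀ x, f (r i x) = f x)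
    (h : Linked r I x y) : f y = f x := by
  induction h using induction with
  | refl => rfl
  | tail y _ i hi ih => rw [hf i hi, ih]

theorem split (hc : ∀ a ∈ A, ∀ b ∈ B, ∀ x, r a (r b x) = r b (r a x)) (hI : I ⊆ A ∪ B)
    (h : Linked r I x y) : ∃ z, Linked r A x z ∧ Linked r B z y := by
  induction h using induction with
  | refl => exact ⟨x, refl x, refl x⟩
  | tail y _ i hi ih =>
    obtain ⟨z, hxz, hzy⟩ := ih
    rcases hI hi with hA | hB
    · exact ⟨r i z, hxz.tail hA, hzy.map (r i) (hc i hA)⟩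
    · exact ⟨z, hxz, hzy.tail hB⟩

theorem eq_of_empty (h : Linked r ∅ x y) : y = x :=
  eq_of_invariant id (fun _ hi => hi.elim) h

theorem eq_or_eq_of_singleton {i : ι} (hr : Function.Involutive (r i)) (h : Linked r {i} x y) :
    y = x ∨ y = r i x := by
  induction h using induction with
  | refl => exact Or.inl rfl
  | tail y _ j hj ih =>
    obtain rfl : j = i := hj
    rcases ih with rfl | rfl
    · exact Or.inr rfl
    · exact Or.inl (hr x)

theorem iff_exists_mem_closure (hr : ∀ i, Function.Involutive (r i)) :
    Linked r I x y ↔ ∃ g ∈ Subgroup.closure (r '' I), g x = y := by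
  constructor
  · intro h
    induction h using induction with
    | refl => exact ⟨1, one_mem _, rfl⟩
    | tail _ _ i hi ih =>
      obtain ⟨g, hg, rfl⟩ := ih
      exact ⟨r i * g, mul_mem (Subgroup.subset_closure ⟨i, hi, rfl⟩) hg, rfl⟩
  · rintro ⟨g, hg, rfl⟩
    induction hg using Subgroup.closure_induction generalizing x with
    | mem g hg =>
      obtain ⟨i, hi, rfl⟩ := hg
      exact step hi x
    | one => exact refl x
    | mul a b _ _ iha ihb => exact ihb.trans iha
    | inv a _ iha => simpa using (iha (x := a⁻¹ x)).symm hr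

end Linked

namespace Maniplex

variable {n : ℕ}

theorem linked_univ (M : Maniplex.{u} n) (x y : M.Flags) : Linked M.r Set.univ x y := by
  rw [Linked.iff_exists_mem_closure M.involutive, Set.image_univ]
  exact M.connected x y

variable {M : Maniplex.{u} n}

theorem r_comm_of_far {i j : Fin n} (h : (i : ℕ) + 2 ≤ j ∨ (j : ℕ) + 2 ≤ i) (x : M.Flags) :
    M.r i (M.r j x) = M.r j (M.r i x) := by
  rcases h with h | h
  · exact M.squares i j h x
  · exact (M.squares j i h x).symm

theorem exists_linked_split {k : ℕ} {x y : M.Flags} (h : Linked M.r {i | (i : ℕ) + 1 ≠ k} x y) :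
    ∃ z, Linked M.r {i | k < (i : ℕ) + 1} x z ∧ Linked M.r {i | (i : ℕ) + 1 < k} z y :=
  h.split (fun a ha b hb => r_comm_of_far (by grind))
    (fun i hi => by grind)

/-- The path intersection property, which characterises the flag graphs of polytopes among
maniplexes: flags in a common orbit for each of the sets of colours `{j}ᶜ`, `j ∉ I`, are joined by
a path with colours in `I`. -/
def IsPolytopal (M : Maniplex.{u} n) : Prop :=
  ∀ (I : Set (Fin n)) (x y : M.Flags), (∀ j ∉ I, Linked M.r {j}ᶜ x y) → Linked M.r I x y

theorem isPolytopal_of_last_notMem {M : Maniplex.{u} (n + 1)}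
    (hM : ∀ (I : Set (Fin (n + 1))) (x y : M.Flags), Fin.last n ∉ I →
      (∀ j ∉ I, Linked M.r {j}ᶜ x y) → Linked M.r I x y) : M.IsPolytopal := by
  intro I x y h
  by_cases hlast : Fin.last n ∉ I
  · exact hM I x y hlast h
  rcases (Iᶜ).eq_empty_or_nonempty with hempty | hne
  · rw [Set.compl_empty_iff.1 hempty]
    exact M.linked_univ x y
  -- Split a path from `x` to `y` at the largest colour `j` missing from `I`: its part above `j`
  -- uses only colours of `I`, and its part below `j` avoids the last colour.
  obtain ⟨j, hj, hmax⟩ : ∃ j ∉ I, ∀ m ∉ I, m ≤ j := (Set.toFinite Iᶜ).exists_maximal hne |>.imp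
    fun j hj => ⟨hj.1, fun m hm => le_of_not_gt fun hlt => hlt.not_ge (hj.2 hm hlt.le)⟩
  have hjlast : j < Fin.last n := Fin.lt_last_iff_ne_last.2 (by rintro rfl; exact hlast hj)
  obtain ⟨v, hxv, hvy⟩ := exists_linked_split (M := M) (k := j + 1)
    ((h j hj).mono fun i hi => by simpa [Fin.ext_iff] using hi)
  have hxvI : Linked M.r I x v := hxv.mono fun i hi => by
    by_contra hiI
    have := hmax i hiI
    grind
  refine hxvI.trans ((hM (I \ {Fin.last n}) v y (by simp) fun m hm => ?_).mono Set.sdiff_subset)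
  by_cases hmlast : m = Fin.last n
  · refine hvy.mono fun i hi => ?_
    simp only [Set.mem_ofPred_eq, Set.mem_compl_iff, Set.mem_singleton_iff, hmlast] at hi ⊢
    grind
  · have hmI : m ∉ I := fun hmI => hm ⟨hmI, hmlast⟩
    exact ((hxvI.mono fun i hi => ne_of_mem_of_not_mem hi hmI).symm M.involutive).trans (h m hmI)

theorem IsPolytopal.of_cover {M M' : Maniplex.{u} (n + 1)} (hM' : M'.IsPolytopal)
    (f : M.Flags → M'.Flags) (hf : ∀ i x, f (M.r i x) = M'.r i (f x))
    (hinj : ∀ x y, Linked M.r {Fin.last n}ᶜ x y → f x = f y → x = y) : M.IsPolytopal := by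
  refine isPolytopal_of_last_notMem fun I x y hI h => ?_
  obtain ⟨z, hxz, hzy⟩ := Linked.lift (r := M.r) f (fun i _ => hf i)
    (hM' I (f x) (f y) fun j hj => (h j hj).map f fun i _ => hf i)
  have hI' : I ⊆ {Fin.last n}ᶜ := fun i hi he => hI (he ▸ hi)
  have hzy' : Linked M.r {Fin.last n}ᶜ z y := ((hxz.mono hI').symm M.involutive).trans (h _ hI)
  rwa [hinj z y hzy' hzy] at hxz

end Maniplex

/-! ### The poset of faces of a maniplex -/

namespace Maniplex

variable {n : ℕ}

/-- A face of height `ht` (its rank plus one) given by one of its flags. -/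
structure PreFace (M : Maniplex.{u} n) : Type u where
  ht : Fin (n + 2)
  flag : M.Flags

/-- Faces are ordered by incidence: they contain a common flag, and their heights are ordered.
Changing the colour `i` of a flag changes its face of height `i + 1` only. -/
instance (M : Maniplex.{u} n) : Preorder M.PreFace where
  le F G := F.ht ≤ G.ht ∧ ∃ z, Linked M.r {i | (i : ℕ) + 1 ≠ F.ht} F.flag z ∧
    Linked M.r {i | (i : ℕ) + 1 ≠ G.ht} z G.flag
  le_refl F := ⟨le_rfl, F.flag, Linked.refl _, Linked.refl _⟩
  le_trans := by
    rintro ⟨k, x⟩ ⟨l, y⟩ ⟨m, w⟩ ⟨hkl, a, hxa, hay⟩ ⟨hlm, b, hyb, hbw⟩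
    obtain ⟨z, haz, hzb⟩ := exists_linked_split (hay.trans hyb)
    refine ⟨hkl.trans hlm, z, hxa.trans (haz.mono ?_), (hzb.mono ?_).trans hbw⟩ <;>
    · intro i hi
      simp only [Set.mem_ofPred_eq, Fin.le_def] at hi hkl hlm ⊢
      omega

/-- The poset of faces of a maniplex, including a least and a greatest face. -/
def Poset (M : Maniplex.{u} n) : Type u := Antisymmetrization M.PreFace (· ≤ ·)

instance (M : Maniplex.{u} n) : PartialOrder M.Poset :=
  inferInstanceAs (PartialOrder (Antisymmetrization M.PreFace (· ≤ ·)))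

/-- The face of height `k`, that is of rank `k - 1`, of a flag of a maniplex. -/
def mkFace (M : Maniplex.{u} n) (k : Fin (n + 2)) (x : M.Flags) : M.Poset :=
  toAntisymmetrization (· ≤ ·) ⟨k, x⟩

variable {M : Maniplex.{u} n} {k l : Fin (n + 2)} {x y : M.Flags}

theorem exists_eq_mkFace (F : M.Poset) : ∃ k x, F = M.mkFace k x := by
  induction F using Antisymmetrization.ind with
  | _ a => exact ⟨a.ht, a.flag, rfl⟩

theorem mkFace_le_mkFace :
    M.mkFace k x ≤ M.mkFace l y ↔ k ≤ l ∧ ∃ z, Linked M.r {i | (i : ℕ) + 1 ≠ k} x z ∧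
      Linked M.r {i | (i : ℕ) + 1 ≠ l} z y := Iff.rfl

theorem mkFace_mono (x : M.Flags) : Monotone (fun k => M.mkFace k x) := fun _ _ h =>
  mkFace_le_mkFace.2 ⟨h, x, Linked.refl _, Linked.refl _⟩

theorem mkFace_eq_mkFace :
    M.mkFace k x = M.mkFace l y ↔ k = l ∧ Linked M.r {i | (i : ℕ) + 1 ≠ k} x y := by
  constructor
  · intro h
    obtain ⟨hkl, z, hxz, hzy⟩ := mkFace_le_mkFace.1 h.le
    obtain rfl := le_antisymm hkl (mkFace_le_mkFace.1 h.ge).1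
    exact ⟨rfl, hxz.trans hzy⟩
  · rintro ⟨rfl, h⟩
    exact le_antisymm (mkFace_le_mkFace.2 ⟨le_rfl, x, Linked.refl _, h⟩)
      (mkFace_le_mkFace.2 ⟨le_rfl, y, Linked.refl _, h.symm M.involutive⟩)

theorem mkFace_eq_iff_linked :
    M.mkFace k x = M.mkFace k y ↔ Linked M.r {i | (i : ℕ) + 1 ≠ k} x y := by
  rw [mkFace_eq_mkFace, and_iff_right rfl]

theorem mkFace_strictMono (x : M.Flags) : StrictMono (fun k => M.mkFace k x) :=
  (mkFace_mono x).strictMono_of_injective fun _ _ h => (mkFace_eq_mkFace.1 h).1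

theorem mkFace_le_mkFace_iff_exists :
    M.mkFace k x ≤ M.mkFace l y ↔
      k ≤ l ∧ ∃ z, M.mkFace k z = M.mkFace k x ∧ M.mkFace l z = M.mkFace l y := by
  rw [mkFace_le_mkFace]
  refine and_congr_right fun _ => exists_congr fun z => and_congr ?_ ?_
  · rw [eq_comm, mkFace_eq_iff_linked]
  · rw [mkFace_eq_iff_linked]

theorem mkFace_eq_of_linked {I : Set (Fin n)} (h : Linked M.r I x y)
    (hk : ∀ i ∈ I, (i : ℕ) + 1 ≠ k) : M.mkFace k x = M.mkFace k y :=
  mkFace_eq_iff_linked.2 (h.mono hk)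

theorem mkFace_r {i : Fin n} (hk : (i : ℕ) + 1 ≠ k) (x : M.Flags) :
    M.mkFace k (M.r i x) = M.mkFace k x :=
  (mkFace_eq_of_linked (Linked.step (Set.mem_singleton i) x) fun _ hj => hj ▸ hk).symm

theorem exists_glue (h : M.mkFace l x = M.mkFace l y) :
    ∃ z, (∀ k ≤ l, M.mkFace k z = M.mkFace k x) ∧ ∀ k ≥ l, M.mkFace k z = M.mkFace k y := by
  obtain ⟨z, hxz, hzy⟩ := exists_linked_split (mkFace_eq_iff_linked.1 h)
  refine ⟨z, fun k hk => (mkFace_eq_of_linked hxz fun i hi => ?_).symm,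
    fun k hk => mkFace_eq_of_linked hzy fun i hi => ?_⟩ <;>
  · simp only [Set.mem_ofPred_eq, Fin.le_def, ge_iff_le] at hi hk
    omega

theorem mkFace_zero_eq (x y : M.Flags) : M.mkFace 0 x = M.mkFace 0 y :=
  mkFace_eq_of_linked (M.linked_univ x y) fun _ _ => Nat.succ_ne_zero _

theorem mkFace_last_eq (x y : M.Flags) :
    M.mkFace (Fin.last (n + 1)) x = M.mkFace (Fin.last (n + 1)) y :=
  mkFace_eq_of_linked (M.linked_univ x y) fun i _ => by rw [Fin.val_last]; omega

noncomputable instance : BoundedOrder M.Poset where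
  bot := M.mkFace 0 (Classical.choice M.nonempty)
  bot_le F := by
    obtain ⟨k, x, rfl⟩ := exists_eq_mkFace F
    rw [mkFace_zero_eq _ x]
    exact mkFace_mono x (Fin.zero_le k)
  top := M.mkFace (Fin.last _) (Classical.choice M.nonempty)
  le_top F := by
    obtain ⟨k, x, rfl⟩ := exists_eq_mkFace F
    rw [mkFace_last_eq _ x]
    exact mkFace_mono x (Fin.le_last k)

theorem mkFace_last (x : M.Flags) : M.mkFace (Fin.last (n + 1)) x = ⊤ := mkFace_last_eq x _

/-- The height of a face, read off a representative; by `height_mkFace` it agrees with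
`Order.height`. -/
noncomputable def Poset.ht (F : M.Poset) : ℕ := (ofAntisymmetrization (· ≤ ·) F : M.PreFace).ht

theorem ht_mkFace (k : Fin (n + 2)) (x : M.Flags) : (M.mkFace k x).ht = k := by
  set a : M.PreFace := ofAntisymmetrization (· ≤ ·) (M.mkFace k x)
  have h : M.mkFace a.ht a.flag = M.mkFace k x :=
    toAntisymmetrization_ofAntisymmetrization (α := M.PreFace) (· ≤ ·) (M.mkFace k x)
  exact congrArg _ (mkFace_eq_mkFace.1 h).1

theorem ht_strictMono : StrictMono (Poset.ht : M.Poset → ℕ) := by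
  intro F G h
  obtain ⟨k, x, rfl⟩ := exists_eq_mkFace F
  obtain ⟨l, y, rfl⟩ := exists_eq_mkFace G
  obtain ⟨-, z, hzx, hzy⟩ := mkFace_le_mkFace_iff_exists.1 h.le
  rw [ht_mkFace, ht_mkFace]
  rw [← hzx, ← hzy, (mkFace_strictMono z).lt_iff_lt] at h
  exact h

theorem height_mkFace (k : Fin (n + 2)) (x : M.Flags) : Order.height (M.mkFace k x) = (k : ℕ) := by
  apply le_antisymm
  · have := Order.height_le_height_apply_of_strictMono _ ht_strictMono (M.mkFace k x)
    rwa [Order.height_nat, ht_mkFace] at this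
  · induction k using Fin.induction with
    | zero => simp
    | succ k ih =>
      calc ((k.succ : ℕ) : ℕ∞) = (k.castSucc : ℕ) + 1 := by simp
        _ ≤ Order.height (M.mkFace k.castSucc x) + 1 := by gcongr
        _ ≤ Order.height (M.mkFace k.succ x) :=
          Order.height_add_one_le (mkFace_strictMono x Fin.castSucc_lt_succ)

theorem faceRank_mkFace (k : Fin (n + 2)) (x : M.Flags) :
    faceRank (M.mkFace k x) = (k : ℤ) - 1 := by
  rw [faceRank, height_mkFace, ENat.toNat_natCast]

theorem finite_of_isChain {s : Set M.Poset} (hs : IsChain (· ≤ ·) s) : s.Finite := by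
  refine Set.Finite.of_injOn (f := Poset.ht) (t := Set.Iio (n + 2)) (fun F _ => ?_)
    (fun F hF G hG h => ?_) (Set.finite_Iio _)
  · obtain ⟨k, x, rfl⟩ := exists_eq_mkFace F
    rw [ht_mkFace]
    exact k.2
  · by_contra hne
    rcases (hs hF hG hne) with hle | hle
    · exact (ht_strictMono (lt_of_le_of_ne hle hne)).ne h
    · exact (ht_strictMono (lt_of_le_of_ne hle (Ne.symm hne))).ne' h

theorem exists_forall_mem_mkFace_eq (s : Finset M.Poset) (hs : IsChain (· ≤ ·) (s : Set M.Poset))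
    (k : Fin (n + 2)) (y : M.Flags) (hy : ∀ F ∈ s, F ≤ M.mkFace k y) :
    ∃ x, M.mkFace k x = M.mkFace k y ∧ ∀ F ∈ s, ∃ l, M.mkFace l x = F := by
  classical
  induction s using Finset.induction_on_max_value (ι := M.Poset) (α := ℕ) Poset.ht
    generalizing k y with
  | empty => exact ⟨y, rfl, by simp⟩
  | insert a s ha hmax ih =>
    rw [Finset.coe_insert] at hs
    obtain ⟨l, z, rfl⟩ := exists_eq_mkFace a
    have hle : ∀ F ∈ s, F ≤ M.mkFace l z := fun F hF =>
      (hs.total (Set.mem_insert_of_mem _ hF) (Set.mem_insert _ _)).resolve_right fun h =>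
        (ht_strictMono (lt_of_le_of_ne h fun e => ha (e ▸ hF))).not_ge (hmax F hF)
    obtain ⟨x, hxz, hx⟩ := ih (hs.mono (Set.subset_insert _ _)) l z hle
    obtain ⟨hlk, w, hwz, hwy⟩ :=
      mkFace_le_mkFace_iff_exists.1 (hy _ (Finset.mem_insert_self _ _))
    obtain ⟨v, hvx, hvw⟩ := exists_glue (hxz.trans hwz.symm)
    refine ⟨v, (hvw k hlk).trans hwy, fun F hF => ?_⟩
    rcases Finset.mem_insert.1 hF with rfl | hF
    · exact ⟨l, (hvx l le_rfl).trans hxz⟩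
    · obtain ⟨j, rfl⟩ := hx F hF
      exact ⟨j, hvx j (mkFace_le_mkFace.1 (hle _ hF)).1⟩

theorem exists_forall_mem_isChain {s : Set M.Poset} (hs : IsChain (· ≤ ·) s) :
    ∃ x, ∀ F ∈ s, ∃ l, M.mkFace l x = F := by
  obtain ⟨x, -, hx⟩ := exists_forall_mem_mkFace_eq (finite_of_isChain hs).toFinset (by simpa)
    (Fin.last _) (Classical.choice M.nonempty) fun F _ => by
      rw [mkFace_last]
      exact le_top
  exact ⟨x, by simpa using hx⟩

theorem eq_of_mem_range_mkFace {F : M.Poset} (h : ∃ l, M.mkFace l x = F)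
    (hF : faceRank F + 1 = (k : ℕ)) : F = M.mkFace k x := by
  obtain ⟨l, rfl⟩ := h
  rw [faceRank_mkFace] at hF
  obtain rfl : l = k := Fin.ext (by omega)
  rfl

/-- The chain of all faces of a flag of the maniplex. -/
def flagOf (x : M.Flags) : Flag M.Poset where
  carrier := Set.range (fun k => M.mkFace k x)
  Chain' := (mkFace_mono x).isChain_range
  max_chain' := by
    intro s hs hsub
    refine hsub.antisymm fun F hF => ?_
    obtain ⟨y, hy⟩ := exists_forall_mem_isChain hs
    obtain ⟨k, rfl⟩ := hy F hF
    obtain ⟨l, hl⟩ := hy _ (hsub ⟨k, rfl⟩)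
    obtain rfl := (mkFace_eq_mkFace.1 hl).1
    exact ⟨l, hl.symm⟩

theorem mem_flagOf {F : M.Poset} : F ∈ flagOf x ↔ ∃ k, M.mkFace k x = F := Iff.rfl

theorem mkFace_mem_flagOf : M.mkFace k x ∈ flagOf y ↔ M.mkFace k x = M.mkFace k y := by
  rw [mem_flagOf]
  constructor
  · rintro ⟨l, h⟩
    obtain rfl := (mkFace_eq_mkFace.1 h).1
    exact h.symm
  · exact fun h => ⟨k, h.symm⟩

theorem ncard_flagOf (x : M.Flags) : ((flagOf x : Flag M.Poset) : Set M.Poset).ncard = n + 2 := by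
  have hrange : ((flagOf x : Flag M.Poset) : Set M.Poset) = (fun k => M.mkFace k x) '' Set.univ :=
    Set.image_univ.symm
  rw [hrange, Set.ncard_image_of_injective _ (mkFace_strictMono x).injective, Set.ncard_univ,
    Nat.card_fin]

theorem flagOf_surjective : Function.Surjective (flagOf : M.Flags → Flag M.Poset) := fun Ψ => by
  obtain ⟨x, hx⟩ := exists_forall_mem_isChain Ψ.chain_le
  exact ⟨x, Flag.ext (Ψ.maxChain.2 (flagOf x).chain_le hx).symm⟩

end Maniplex

/-! ### Polytopes from polytopal maniplexes -/

namespace Maniplex.IsPolytopal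

variable {n : ℕ} {M : Maniplex.{u} n} (hM : M.IsPolytopal) {x y : M.Flags}
include hM

theorem linked {I : Set (Fin n)}
    (h : ∀ j ∉ I, M.mkFace j.succ.castSucc x = M.mkFace j.succ.castSucc y) : Linked M.r I x y :=
  hM I x y fun j hj => (mkFace_eq_iff_linked.1 (h j hj)).mono fun i hi => by
    simpa [Fin.ext_iff] using hi

theorem eq_of_forall_mkFace_eq (h : ∀ k, M.mkFace k x = M.mkFace k y) : x = y :=
  (Linked.eq_of_empty (hM.linked fun _ _ => h _)).symm

theorem flagOf_injective : Function.Injective (flagOf : M.Flags → Flag M.Poset) := fun _ _ h =>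
  hM.eq_of_forall_mkFace_eq fun k => mkFace_mem_flagOf.1 (h ▸ ⟨k, rfl⟩)

theorem mkFace_r_ne (i : Fin n) (x : M.Flags) :
    M.mkFace i.succ.castSucc (M.r i x) ≠ M.mkFace i.succ.castSucc x := fun h =>
  M.fixed_point_free i x <| hM.eq_of_forall_mkFace_eq fun k => by
    by_cases hk : k = i.succ.castSucc
    · rw [hk, h]
    · exact mkFace_r (fun e => hk (Fin.ext e.symm)) x

theorem eq_or_eq_r {i : Fin n} (h : ∀ k ≠ i.succ.castSucc, M.mkFace k x = M.mkFace k y) :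
    y = x ∨ y = M.r i x :=
  Linked.eq_or_eq_of_singleton (M.involutive i) <| hM.linked fun j hj =>
    h _ fun e => hj (by simpa using e)

theorem flagAdj_flagOf {i : Fin n} : FlagAdj (i : ℕ) (flagOf x) (flagOf y) ↔ y = M.r i x := by
  constructor
  · rintro ⟨hne, h⟩
    refine (hM.eq_or_eq_r fun k hk => ?_).resolve_left fun e => hne (e ▸ rfl)
    refine mkFace_mem_flagOf.1 ((h _ ?_).1 ⟨k, rfl⟩)
    rw [faceRank_mkFace]
    contrapose! hk
    exact Fin.ext (by grind)
  · rintro rfl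
    refine ⟨fun e => M.fixed_point_free i x (hM.flagOf_injective e).symm, fun F hF => ?_⟩
    obtain ⟨k, z, rfl⟩ := exists_eq_mkFace F
    rw [faceRank_mkFace] at hF
    rw [mkFace_mem_flagOf, mkFace_mem_flagOf, mkFace_r (by omega)]

theorem eq_or_eq_of_between {i : Fin n} {G : M.Poset}
    (hFG : M.mkFace i.castSucc.castSucc x < G) (hGH : G < M.mkFace i.succ.succ x) :
    G = M.mkFace i.succ.castSucc x ∨ G = M.mkFace i.succ.castSucc (M.r i x) := by
  have hchain : IsChain (· ≤ ·) {M.mkFace i.castSucc.castSucc x, G, M.mkFace i.succ.succ x} :=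
    (IsChain.pair hGH.le).insert fun K hK _ => by
      rcases hK with rfl | rfl
      exacts [Or.inl hFG.le, Or.inl (hFG.trans hGH).le]
  obtain ⟨y, hy⟩ := exists_forall_mem_isChain hchain
  have hF := mkFace_mem_flagOf.1 (hy (M.mkFace i.castSucc.castSucc x) (by simp))
  have hH := mkFace_mem_flagOf.1 (hy (M.mkFace i.succ.succ x) (by simp))
  obtain ⟨k, rfl⟩ := hy G (by simp)
  rw [hF, (mkFace_strictMono y).lt_iff_lt] at hFG
  rw [hH, (mkFace_strictMono y).lt_iff_lt] at hGH
  obtain rfl : k = i.succ.castSucc := by grind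
  -- Replace the faces of `y` of height at most `i` and at least `i + 2` by those of `x`.
  obtain ⟨z, hzx, hzy⟩ := exists_glue hF
  obtain ⟨w, hwz, hwx⟩ := exists_glue ((hzy _ (by grind)).trans hH.symm)
  have hw : M.mkFace i.succ.castSucc w = M.mkFace i.succ.castSucc y :=
    (hwz _ (by simp [Fin.le_def])).trans (hzy _ (by simp [Fin.le_def]))
  have hxw : ∀ k ≠ i.succ.castSucc, M.mkFace k x = M.mkFace k w := fun k hk => by
    rcases lt_or_gt_of_ne hk with hk | hk
    · rw [hwz k (by grind), hzx k (by grind)]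
    · rw [hwx k (by grind)]
  rw [← hw]
  exact (hM.eq_or_eq_r hxw).imp (by rintro rfl; rfl) (by rintro rfl; rfl)

theorem between_iff {i : Fin n} {G : M.Poset} :
    M.mkFace i.castSucc.castSucc x < G ∧ G < M.mkFace i.succ.succ x ↔
      G = M.mkFace i.succ.castSucc x ∨ G = M.mkFace i.succ.castSucc (M.r i x) := by
  refine ⟨fun h => hM.eq_or_eq_of_between h.1 h.2, ?_⟩
  have hmid : ∀ z, M.mkFace i.castSucc.castSucc z < M.mkFace i.succ.castSucc z ∧
      M.mkFace i.succ.castSucc z < M.mkFace i.succ.succ z := fun z =>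
    ⟨mkFace_strictMono z (by simp [Fin.lt_def]), mkFace_strictMono z (by simp [Fin.lt_def])⟩
  rintro (rfl | rfl)
  · exact hmid x
  · simpa only [mkFace_r (i := i) (k := i.castSucc.castSucc) (by simp),
      mkFace_r (i := i) (k := i.succ.succ) (by simp)] using hmid (M.r i x)

theorem ncard_between {i : ℕ} (hi : i < n) {F H : M.Poset} (hF : faceRank F = (i : ℤ) - 1)
    (hH : faceRank H = (i : ℤ) + 1) (hFH : F ≤ H) : {G | F < G ∧ G < H}.ncard = 2 := by
  obtain ⟨x, hx⟩ := exists_forall_mem_isChain (IsChain.pair hFH)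
  obtain rfl := eq_of_mem_range_mkFace (k := Fin.castSucc (Fin.castSucc ⟨i, hi⟩))
    (hx F (by simp)) (by simp [hF])
  obtain rfl := eq_of_mem_range_mkFace (k := Fin.succ (Fin.succ ⟨i, hi⟩))
    (hx H (by simp)) (by simp [hH])
  simp only [hM.between_iff]
  exact Set.ncard_pair (hM.mkFace_r_ne ⟨i, hi⟩ x).symm

theorem stronglyFlagConnected (x y : M.Flags) :
    Relation.ReflTransGen (fun A B : Flag M.Poset => (∃ i : ℤ, FlagAdj i A B) ∧
      (flagOf x : Set M.Poset) ∩ (flagOf y : Flag M.Poset) ⊆ B) (flagOf x) (flagOf y) := by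
  set I : Set (Fin n) := {j | M.mkFace j.succ.castSucc x ≠ M.mkFace j.succ.castSucc y}
  have hcommon : ∀ z, Linked M.r I x z →
      (flagOf x : Set M.Poset) ∩ (flagOf y : Flag M.Poset) ⊆ (flagOf z : Flag M.Poset) := by
    rintro z hz F ⟨⟨k, rfl⟩, hk⟩
    refine mkFace_mem_flagOf.2 (mkFace_eq_of_linked hz fun i hi e => hi ?_)
    obtain rfl : k = i.succ.castSucc := Fin.ext e.symm
    exact mkFace_mem_flagOf.1 hk
  suffices hpath : ∀ z, Linked M.r I x z → Relation.ReflTransGen _ (flagOf x) (flagOf z) from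
    hpath y (hM.linked fun j hj => not_not.1 hj)
  intro z hz
  induction hz using Linked.induction with
  | refl => exact Relation.ReflTransGen.refl
  | tail z hz i hi ih => exact ih.tail ⟨⟨_, hM.flagAdj_flagOf.2 rfl⟩, hcommon _ (hz.tail hi)⟩

theorem isPolytope : IsPolytope n M.Poset where
  flag_card Φ := by
    obtain ⟨x, rfl⟩ := flagOf_surjective Φ
    exact ncard_flagOf x
  diamond i hi F H hF hH hFH := hM.ncard_between hi hF hH hFH
  strongly_flag_connected Φ Ψ := by
    obtain ⟨x, rfl⟩ := flagOf_surjective Φ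
    obtain ⟨y, rfl⟩ := flagOf_surjective Ψ
    exact hM.stronglyFlagConnected x y

end Maniplex.IsPolytopal

/-! ### The flag graph of a polytope -/

theorem faceRank_orderIso {α β : Type u} [PartialOrder α] [PartialOrder β] (e : α ≃o β) (F : α) :
    faceRank (e F) = faceRank F := by
  rw [faceRank, faceRank, Order.height_orderIso]

theorem flag_eq_of_subset {α : Type*} [PartialOrder α] {Φ Ψ : Flag α}
    (h : (Φ : Set α) ⊆ Ψ) : Φ = Ψ :=
  Flag.ext (Φ.maxChain.2 Ψ.chain_le h)

namespace FlagAdj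

variable {α β : Type u} [PartialOrder α] [PartialOrder β] {i : ℤ} {Φ Ψ : Flag α}

theorem symm (h : FlagAdj i Φ Ψ) : FlagAdj i Ψ Φ :=
  ⟨h.1.symm, fun F hF => (h.2 F hF).symm⟩

theorem map (h : FlagAdj i Φ Ψ) (e : α ≃o β) : FlagAdj i (Flag.map e Φ) (Flag.map e Ψ) := by
  refine ⟨fun he => h.1 ((Flag.map e).injective he), fun F hF => ?_⟩
  have hmem : ∀ Ω : Flag α, F ∈ Flag.map e Ω ↔ e.symm F ∈ Ω := fun Ω => by
    rw [← Flag.mem_coe_iff, Flag.coe_map, e.image_eq_preimage_symm]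
    rfl
  rw [hmem, hmem]
  exact h.2 _ (by rwa [faceRank_orderIso])

end FlagAdj

namespace IsPolytope

variable {N : ℕ} {α : Type u} [PartialOrder α] [BoundedOrder α] (h : IsPolytope N α)
include h

theorem finite_flag (Φ : Flag α) : (Φ : Set α).Finite :=
  Set.finite_of_ncard_ne_zero (by rw [h.flag_card Φ]; omega)

theorem height_le (F : α) : Order.height F ≤ (N + 1 : ℕ) := by
  refine Order.height_le fun p _ => ?_
  obtain ⟨Φ, hΦ⟩ := p.strictMono.monotone.isChain_range.exists_subset_flag
  have hcard := Set.ncard_le_ncard hΦ (h.finite_flag Φ)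
  rw [h.flag_card, ← Set.image_univ, Set.ncard_image_of_injective _ p.strictMono.injective,
    Set.ncard_univ, Nat.card_fin] at hcard
  exact_mod_cast (by omega : p.length ≤ N + 1)

theorem faceRank_strictMono : StrictMono (faceRank : α → ℤ) := by
  intro F G hFG
  have hfin : ∀ F : α, Order.height F ≠ ⊤ := fun F =>
    ne_top_of_le_ne_top (ENat.natCast_ne_top _) (h.height_le F)
  have := Order.height_strictMono hFG (lt_top_iff_ne_top.2 (hfin F))
  rw [← ENat.natCast_toNat (hfin F), ← ENat.natCast_toNat (hfin G), Nat.cast_lt] at this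
  simp only [faceRank]
  omega

theorem exists_faceRank_eq (F : α) : ∃ k : Fin (N + 2), faceRank F = (k : ℤ) - 1 := by
  have := ENat.toNat_le_of_le_natCast (h.height_le F)
  exact ⟨⟨(Order.height F).toNat, by omega⟩, rfl⟩

theorem eq_of_mem {Φ : Flag α} {F G : α} (hF : F ∈ Φ) (hG : G ∈ Φ)
    (hFG : faceRank F = faceRank G) : F = G := by
  rcases Φ.le_or_le hF hG with hle | hle
  · exact hle.eq_or_lt.resolve_right fun hlt => (h.faceRank_strictMono hlt).ne hFG
  · exact (hle.eq_or_lt.resolve_right fun hlt => (h.faceRank_strictMono hlt).ne hFG.symm).symm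

theorem exists_face (Φ : Flag α) (k : Fin (N + 2)) : ∃ F ∈ Φ, faceRank F = (k : ℤ) - 1 := by
  choose g hg using h.exists_faceRank_eq
  have hinj : Set.InjOn g (Φ : Set α) := fun F hF G hG e =>
    h.eq_of_mem hF hG (by rw [hg, hg, e])
  have himage : g '' (Φ : Set α) = Set.univ := by
    apply Set.eq_of_subset_of_ncard_le (Set.subset_univ _)
    rw [hinj.ncard_image, h.flag_card, Set.ncard_univ, Nat.card_fin]
  obtain ⟨F, hF, rfl⟩ := himage.ge (Set.mem_univ k)
  exact ⟨F, hF, hg F⟩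

/-- The face of height `k`, that is of rank `k - 1`, of a flag of a polytope. -/
noncomputable def face (Φ : Flag α) (k : Fin (N + 2)) : α := (h.exists_face Φ k).choose

theorem face_mem (Φ : Flag α) (k : Fin (N + 2)) : h.face Φ k ∈ Φ :=
  (h.exists_face Φ k).choose_spec.1

theorem faceRank_face (Φ : Flag α) (k : Fin (N + 2)) : faceRank (h.face Φ k) = (k : ℤ) - 1 :=
  (h.exists_face Φ k).choose_spec.2

theorem eq_face {Φ : Flag α} {F : α} (hF : F ∈ Φ) {k : Fin (N + 2)}
    (hk : faceRank F = (k : ℤ) - 1) : F = h.face Φ k :=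
  h.eq_of_mem hF (h.face_mem Φ k) (hk.trans (h.faceRank_face Φ k).symm)

theorem face_mem_iff {Φ Ψ : Flag α} {k : Fin (N + 2)} :
    h.face Φ k ∈ Ψ ↔ h.face Φ k = h.face Ψ k :=
  ⟨fun hm => h.eq_face hm (h.faceRank_face Φ k), fun e => e ▸ h.face_mem Ψ k⟩

theorem exists_eq_face {Φ : Flag α} {F : α} (hF : F ∈ Φ) : ∃ k, F = h.face Φ k := by
  obtain ⟨k, hk⟩ := h.exists_faceRank_eq F
  exact ⟨k, h.eq_face hF hk⟩

theorem face_strictMono (Φ : Flag α) : StrictMono (h.face Φ) := by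
  intro k l hkl
  have hrank : faceRank (h.face Φ k) < faceRank (h.face Φ l) := by
    rw [h.faceRank_face, h.faceRank_face]
    rw [Fin.lt_def] at hkl
    omega
  rcases Φ.le_or_le (h.face_mem Φ k) (h.face_mem Φ l) with hle | hle
  · exact lt_of_le_of_ne hle fun e => hrank.ne (by rw [e])
  · exact absurd (h.faceRank_strictMono.monotone hle) (not_le.2 hrank)

theorem face_le_face_iff {Φ : Flag α} {k l : Fin (N + 2)} : h.face Φ k ≤ h.face Φ l ↔ k ≤ l :=
  (h.face_strictMono Φ).le_iff_le

theorem flag_ext {Φ Ψ : Flag α} (hk : ∀ k, h.face Φ k = h.face Ψ k) : Φ = Ψ := by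
  refine flag_eq_of_subset fun F hF => ?_
  obtain ⟨k, rfl⟩ := h.exists_eq_face hF
  exact h.face_mem_iff.2 (hk k)

theorem face_zero (Φ : Flag α) : h.face Φ 0 = ⊥ :=
  (h.eq_face Φ.bot_mem (by simp [faceRank])).symm

theorem face_last (Φ : Flag α) : h.face Φ (Fin.last _) = ⊤ := by
  obtain ⟨k, hk⟩ := h.exists_eq_face Φ.top_mem
  exact le_antisymm le_top (hk ▸ h.face_le_face_iff.2 (Fin.le_last k))

theorem flagAdj_iff_face {i : Fin N} {Φ Ψ : Flag α} : FlagAdj (i : ℕ) Φ Ψ ↔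
    (∀ k : Fin (N + 2), (k : ℕ) ≠ i + 1 → h.face Φ k = h.face Ψ k) ∧
      h.face Φ i.succ.castSucc ≠ h.face Ψ i.succ.castSucc := by
  constructor
  · rintro ⟨hne, hiff⟩
    have hother : ∀ k : Fin (N + 2), (k : ℕ) ≠ i + 1 → h.face Φ k = h.face Ψ k := fun k hk => by
      rw [← h.face_mem_iff, ← hiff _ (by rw [h.faceRank_face]; omega)]
      exact h.face_mem Φ k
    refine ⟨hother, fun e => hne (h.flag_ext fun k => ?_)⟩
    by_cases hk : k = i.succ.castSucc
    · rw [hk, e]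
    · exact hother k fun hk' => hk (Fin.ext hk')
  · rintro ⟨hother, hne⟩
    refine ⟨fun e => hne (by rw [e]), fun F hF => ?_⟩
    constructor <;>
    · intro hm
      obtain ⟨k, rfl⟩ := h.exists_eq_face hm
      rw [h.faceRank_face] at hF
      rw [h.face_mem_iff, hother k (by omega)]

theorem exists_eq_of_flagAdj {i : ℤ} {Φ Ψ : Flag α} (hadj : FlagAdj i Φ Ψ) :
    ∃ j : Fin N, i = (j : ℕ) := by
  by_contra! hi
  refine hadj.1 (h.flag_ext fun k => ?_)
  by_cases hk0 : k = 0
  · rw [hk0, h.face_zero, h.face_zero]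
  by_cases hkl : k = Fin.last _
  · rw [hkl, h.face_last, h.face_last]
  have hk1 : (k : ℕ) ≠ 0 := fun e => hk0 (Fin.ext e)
  have hk2 : (k : ℕ) ≠ N + 1 := fun e => hkl (Fin.ext e)
  rw [← h.face_mem_iff, ← hadj.2]
  · exact h.face_mem Φ k
  · rw [h.faceRank_face]
    have := hi ⟨k - 1, by omega⟩
    simp only at this
    omega

theorem exists_flag_eq {c : Set α} (hc : IsChain (· ≤ ·) c) (hcard : c.ncard = N + 2) :
    ∃ Φ : Flag α, (Φ : Set α) = c := by
  obtain ⟨Φ, hΦ⟩ := hc.exists_subset_flag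
  exact ⟨Φ, (Set.eq_of_subset_of_ncard_le hΦ (by rw [h.flag_card, hcard]) (h.finite_flag Φ)).symm⟩

theorem ncard_between_face (Φ : Flag α) (i : Fin N) :
    {G | h.face Φ i.castSucc.castSucc < G ∧ G < h.face Φ i.succ.succ}.ncard = 2 :=
  h.diamond i i.2 _ _ (by rw [h.faceRank_face]; simp) (by rw [h.faceRank_face]; simp)
    (h.face_le_face_iff.2 (by grind))

theorem face_between (Φ : Flag α) (i : Fin N) :
    h.face Φ i.castSucc.castSucc < h.face Φ i.succ.castSucc ∧
      h.face Φ i.succ.castSucc < h.face Φ i.succ.succ :=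
  ⟨h.face_strictMono Φ (by simp [Fin.lt_def]), h.face_strictMono Φ (by simp [Fin.lt_def])⟩

theorem faceRank_of_between {Φ : Flag α} {i : Fin N} {G : α}
    (hlow : h.face Φ i.castSucc.castSucc < G) (hhigh : G < h.face Φ i.succ.succ) :
    faceRank G = (i : ℕ) := by
  have hl := h.faceRank_strictMono hlow
  have hh := h.faceRank_strictMono hhigh
  rw [h.faceRank_face] at hl hh
  simp only [Fin.val_castSucc, Fin.val_succ] at hl hh
  omega

theorem exists_flag_replace {Φ : Flag α} {i : Fin N} {G : α}
    (hlow : h.face Φ i.castSucc.castSucc < G) (hhigh : G < h.face Φ i.succ.succ) (hG : G ∉ Φ) :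
    ∃ Ψ : Flag α, (Ψ : Set α) = insert G ((Φ : Set α) \ {h.face Φ i.succ.castSucc}) := by
  refine h.exists_flag_eq ((Φ.chain_le.mono Set.sdiff_subset).insert ?_) ?_
  · rintro A ⟨hA, hAne⟩ -
    obtain ⟨k, rfl⟩ := h.exists_eq_face hA
    have hk : k ≠ i.succ.castSucc := by
      rintro rfl
      exact hAne rfl
    rcases lt_or_gt_of_ne hk with hk | hk
    · exact Or.inr ((h.face_le_face_iff.2 (by grind)).trans
        hlow.le)
    · exact Or.inl (hhigh.le.trans
        (h.face_le_face_iff.2 (by grind)))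
  · rw [Set.ncard_insert_of_notMem (fun hm => hG hm.1) ((h.finite_flag Φ).subset Set.sdiff_subset),
      Set.ncard_sdiff_singleton_add_one (h.face_mem Φ _) (h.finite_flag Φ), h.flag_card]

theorem exists_flagAdj (i : Fin N) (Φ : Flag α) : ∃ Ψ, FlagAdj (i : ℕ) Φ Ψ := by
  obtain ⟨G, ⟨hlow, hhigh⟩, hGne⟩ := Set.exists_ne_of_one_lt_ncard
    (by rw [h.ncard_between_face Φ i]; norm_num) (h.face Φ i.succ.castSucc)
  have hrank := h.faceRank_of_between hlow hhigh
  have hGΦ : G ∉ Φ := fun hG => hGne (h.eq_face hG (by rw [hrank]; simp))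
  obtain ⟨Ψ, hΨ⟩ := h.exists_flag_replace hlow hhigh hGΦ
  have hmem : ∀ A, A ∈ Ψ ↔ A = G ∨ A ∈ Φ ∧ A ≠ h.face Φ i.succ.castSucc := fun A => by
    rw [← Flag.mem_coe_iff, hΨ]
    rfl
  refine ⟨Ψ, fun e => hGΦ (e ▸ (hmem G).2 (Or.inl rfl)), fun A hA => ?_⟩
  rw [hmem]
  constructor
  · refine fun hm => Or.inr ⟨hm, fun e => hA ?_⟩
    rw [e, h.faceRank_face]
    simp
  · rintro (rfl | hm)
    · exact absurd hrank hA
    · exact hm.1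

theorem face_eq_of_flagAdj {i : Fin N} {Φ Φ' Ψ Ψ' : Flag α} (hΦ : FlagAdj (i : ℕ) Φ Φ')
    (hΨ : FlagAdj (i : ℕ) Ψ Ψ')
    (hk : ∀ k : Fin (N + 2), (i : ℕ) ≤ k → (k : ℕ) ≤ i + 2 → h.face Φ k = h.face Ψ k) :
    h.face Φ' i.succ.castSucc = h.face Ψ' i.succ.castSucc := by
  rw [h.flagAdj_iff_face] at hΦ hΨ
  obtain ⟨hΦ, hΦne⟩ := hΦ
  obtain ⟨hΨ, hΨne⟩ := hΨ
  obtain ⟨A, B, -, hAB⟩ := Set.ncard_eq_two.1 (h.ncard_between_face Φ i)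
  have hmem := hAB.le (h.face_between Φ i)
  have hmemΦ' : h.face Φ' i.succ.castSucc ∈ ({A, B} : Set α) := hAB.le (by
    rw [Set.mem_ofPred_eq, hΦ _ (by simp), hΦ i.succ.succ (by simp)]
    exact h.face_between Φ' i)
  have hmemΨ' : h.face Ψ' i.succ.castSucc ∈ ({A, B} : Set α) := hAB.le (by
    rw [Set.mem_ofPred_eq, hk _ (by simp) (by simp), hk i.succ.succ (by grind) (by simp),
      hΨ _ (by simp), hΨ i.succ.succ (by simp)]
    exact h.face_between Ψ' i)
  rw [← hk _ (by simp) (by simp)] at hΨne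
  simp only [Set.mem_insert_iff, Set.mem_singleton_iff] at hmem hmemΦ' hmemΨ'
  grind

theorem flagAdj_unique {i : Fin N} {Φ Ψ Ψ' : Flag α} (hΨ : FlagAdj (i : ℕ) Φ Ψ)
    (hΨ' : FlagAdj (i : ℕ) Φ Ψ') : Ψ = Ψ' := by
  refine h.flag_ext fun k => ?_
  by_cases hk : k = i.succ.castSucc
  · rw [hk]
    exact h.face_eq_of_flagAdj hΨ hΨ' fun _ _ _ => rfl
  · have hk' : (k : ℕ) ≠ i + 1 := fun e => hk (Fin.ext e)
    rw [← (h.flagAdj_iff_face.1 hΨ).1 k hk', (h.flagAdj_iff_face.1 hΨ').1 k hk']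

/-- The flag of a polytope that is `i`-adjacent to a given one. -/
noncomputable def adj (i : Fin N) (Φ : Flag α) : Flag α := (h.exists_flagAdj i Φ).choose

theorem flagAdj_adj (i : Fin N) (Φ : Flag α) : FlagAdj (i : ℕ) Φ (h.adj i Φ) :=
  (h.exists_flagAdj i Φ).choose_spec

theorem flagAdj_iff {i : Fin N} {Φ Ψ : Flag α} : FlagAdj (i : ℕ) Φ Ψ ↔ Ψ = h.adj i Φ :=
  ⟨fun hadj => h.flagAdj_unique hadj (h.flagAdj_adj i Φ), fun e => e ▸ h.flagAdj_adj i Φ⟩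

theorem adj_involutive (i : Fin N) : Function.Involutive (h.adj i) := fun Φ =>
  (h.flagAdj_iff.1 (h.flagAdj_adj i Φ).symm).symm

theorem face_adj {i : Fin N} {Φ : Flag α} {k : Fin (N + 2)} (hk : (k : ℕ) ≠ i + 1) :
    h.face (h.adj i Φ) k = h.face Φ k :=
  ((h.flagAdj_iff_face.1 (h.flagAdj_adj i Φ)).1 k hk).symm

theorem face_adj_ne (i : Fin N) (Φ : Flag α) :
    h.face Φ i.succ.castSucc ≠ h.face (h.adj i Φ) i.succ.castSucc :=
  (h.flagAdj_iff_face.1 (h.flagAdj_adj i Φ)).2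

theorem adj_comm {i j : Fin N} (hij : (i : ℕ) + 2 ≤ j) (Φ : Flag α) :
    h.adj i (h.adj j Φ) = h.adj j (h.adj i Φ) := by
  rw [← h.flagAdj_iff, h.flagAdj_iff_face]
  have hi : h.face (h.adj i (h.adj j Φ)) i.succ.castSucc = h.face (h.adj i Φ) i.succ.castSucc :=
    h.face_eq_of_flagAdj (h.flagAdj_adj i _) (h.flagAdj_adj i _) fun k _ _ => h.face_adj (by omega)
  refine ⟨fun k hk => ?_, ?_⟩
  · by_cases hki : k = i.succ.castSucc
    · rw [hki, hi]
    · have hki' : (k : ℕ) ≠ i + 1 := fun e => hki (Fin.ext e)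
      rw [h.face_adj hki', h.face_adj hki', h.face_adj hk]
  · rw [h.face_adj (by grind), h.face_adj (by grind)]
    exact h.face_adj_ne j Φ

/-- The permutation of the flags of a polytope that exchanges `i`-adjacent flags. -/
noncomputable def adjPerm (i : Fin N) : Equiv.Perm (Flag α) :=
  (h.adj_involutive i).toPerm (h.adj i)

theorem linked_adjPerm {I : Set (Fin N)} {Φ Ψ : Flag α}
    (hΦΨ : ∀ j ∉ I, h.face Φ j.succ.castSucc = h.face Ψ j.succ.castSucc) :
    Linked h.adjPerm I Φ Ψ := by
  suffices hpath : ∀ B : Flag α, Relation.ReflTransGen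
      (fun A B : Flag α => (∃ i : ℤ, FlagAdj i A B) ∧ (Φ : Set α) ∩ Ψ ⊆ B) Φ B →
      Linked h.adjPerm I Φ B ∧ (Φ : Set α) ∩ Ψ ⊆ B from
    (hpath Ψ (h.strongly_flag_connected Φ Ψ)).1
  intro B hB
  induction hB with
  | refl => exact ⟨Linked.refl _, Set.inter_subset_left⟩
  | @tail A B _ hstep ih =>
    obtain ⟨⟨i, hi⟩, hB⟩ := hstep
    obtain ⟨hlinked, hA⟩ := ih
    obtain ⟨j, rfl⟩ := h.exists_eq_of_flagAdj hi
    have hj : j ∈ I := by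
      by_contra hj
      have hmem : h.face Φ j.succ.castSucc ∈ (Φ : Set α) ∩ Ψ :=
        ⟨h.face_mem _ _, h.face_mem_iff.2 (hΦΨ j hj)⟩
      exact (h.flagAdj_iff_face.1 hi).2
        ((h.face_mem_iff.1 (hA hmem)).symm.trans (h.face_mem_iff.1 (hB hmem)))
    obtain rfl : B = h.adjPerm j A := h.flagAdj_iff.1 hi
    exact ⟨hlinked.tail hj, hB⟩

/-- The maniplex formed by the flags of a polytope. -/
noncomputable def flagManiplex : Maniplex.{u} N where
  Flags := Flag α
  r := h.adjPerm
  nonempty := ⟨(IsChain.exists_subset_flag (c := (∅ : Set α)) (by simp)).choose⟩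
  involutive := h.adj_involutive
  fixed_point_free i Φ e := (h.flagAdj_adj i Φ).1 e.symm
  distinct i j Φ hij e := by
    apply h.face_adj_ne i Φ
    have : h.adj i Φ = h.adj j Φ := e
    rw [this, h.face_adj]
    simpa [Fin.ext_iff] using hij
  squares i j hij Φ := h.adj_comm hij Φ
  connected Φ Ψ := by
    rw [← Set.image_univ, ← Linked.iff_exists_mem_closure h.adj_involutive]
    exact h.linked_adjPerm (by simp)

theorem face_eq_of_linked {I : Set (Fin N)} {Φ Ψ : Flag α} (hl : Linked h.flagManiplex.r I Φ Ψ)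
    {k : Fin (N + 2)} (hk : ∀ i ∈ I, (i : ℕ) + 1 ≠ k) : h.face Ψ k = h.face Φ k :=
  Linked.eq_of_invariant (fun Ω => h.face Ω k)
    (fun i hi _ => h.face_adj (fun e => hk i hi e.symm)) hl

theorem isPolytopal_flagManiplex : h.flagManiplex.IsPolytopal := fun I Φ Ψ hI =>
  h.linked_adjPerm fun j hj => (h.face_eq_of_linked (hI j hj) fun i hi => by
    simpa [Fin.ext_iff] using hi).symm

theorem flag_induction {motive : Flag α → Prop} (Φ₀ : Flag α) (base : motive Φ₀)
    (adj : ∀ i Φ, motive Φ → motive (h.adj i Φ)) (Φ : Flag α) : motive Φ := by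
  induction h.flagManiplex.linked_univ Φ₀ Φ using Linked.induction with
  | refl => exact base
  | tail Ψ _ i _ ih => exact adj i Ψ ih

/-! ### Automorphisms and colourings of polytopes -/

section

variable {β : Type u} [PartialOrder β] [BoundedOrder β] (h' : IsPolytope N β) (e : α ≃o β)
include h'

theorem map_adj (i : Fin N) (Φ : Flag α) :
    Flag.map e (h.adj i Φ) = h'.adj i (Flag.map e Φ) :=
  h'.flagAdj_iff.1 ((h.flagAdj_adj i Φ).map e)

theorem map_face (Φ : Flag α) (k : Fin (N + 2)) : e (h.face Φ k) = h'.face (Flag.map e Φ) k :=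
  h'.eq_face (Set.mem_image_of_mem e (h.face_mem Φ k)) (by rw [faceRank_orderIso, h.faceRank_face])

end

theorem orderIso_ext {e e' : α ≃o α} {Φ : Flag α} (hΦ : Flag.map e Φ = Flag.map e' Φ) :
    e = e' := by
  have hall : ∀ Ψ, Flag.map e Ψ = Flag.map e' Ψ := h.flag_induction Φ hΦ fun i Ψ ih => by
    rw [h.map_adj h, h.map_adj h, ih]
  ext F
  obtain ⟨Ψ, hF⟩ := Flag.exists_mem F
  obtain ⟨k, rfl⟩ := h.exists_eq_face hF
  rw [h.map_face h, h.map_face h, hall]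

theorem isFlagColouring_iff {c : Flag α → Bool} :
    IsFlagColouring c ↔ ∀ i Φ, c (h.adj i Φ) = !c Φ := by
  constructor
  · exact fun hc i Φ => Bool.eq_not_of_ne (hc _ _ _ (h.flagAdj_adj i Φ)).symm
  · intro hc i Φ Ψ hadj
    obtain ⟨j, rfl⟩ := h.exists_eq_of_flagAdj hadj
    rw [h.flagAdj_iff.1 hadj, hc]
    exact (Bool.not_ne_self _).symm

theorem colouring_eq {c c' : Flag α → Bool} (hc : IsFlagColouring c) (hc' : IsFlagColouring c')
    {Φ : Flag α} (hΦ : c Φ = c' Φ) : c = c' := by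
  rw [h.isFlagColouring_iff] at hc hc'
  exact funext <| h.flag_induction Φ hΦ fun i Ψ ih => by rw [hc, hc', ih]

theorem mem_whiteFlags_iff {c : Flag α → Bool} (hc : IsFlagColouring c) {Φ Ψ : Flag α} :
    Ψ ∈ whiteFlags Φ ↔ c Ψ = c Φ := by
  refine ⟨fun hw => hw c hc, fun e c' hc' => ?_⟩
  by_cases hΦ : c' Φ = c Φ
  · rw [h.colouring_eq hc' hc hΦ, e]
  · have hnot : IsFlagColouring fun Φ => !c Φ := fun i A B hAB => by simpa using hc i A B hAB
    rw [h.colouring_eq hc' hnot (Φ := Φ) (Bool.eq_not_of_ne hΦ)]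
    simp [e]

theorem comp_map_colouring {c : Flag α → Bool} (hc : IsFlagColouring c) {e : α ≃o α} {Φ : Flag α}
    (hΦ : c (Flag.map e Φ) = c Φ) (Ψ : Flag α) : c (Flag.map e Ψ) = c Ψ :=
  congrFun (h.colouring_eq (c := fun Ψ => c (Flag.map e Ψ))
    (fun i _ _ hAB => hc i _ _ (hAB.map e)) hc hΦ) Ψ

end IsPolytope

theorem IsChiralPolytope.exists_colouring {α : Type u} [PartialOrder α]
    (hα : IsChiralPolytope α) : ∃ c : Flag α → Bool, IsFlagColouring c := by
  by_contra! hno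
  refine hα.2 fun Φ Ψ => ?_
  obtain ⟨γ, -, hγ⟩ := hα.1 Φ Φ (fun c hc => absurd hc (hno c)) Ψ (fun c hc => absurd hc (hno c))
  exact ⟨γ, hγ⟩

/-! ### Automorphisms of `2s^(M - 1)` -/

theorem minimalPeriod_eq_of_forall_dvd {X : Type*} {f : X → X} {x : X} {d : ℕ}
    (h : ∀ m, Function.IsPeriodicPt f m x ↔ d ∣ m) : Function.minimalPeriod f x = d :=
  Nat.dvd_antisymm (((h d).2 dvd_rfl).minimalPeriod_dvd)
    ((h _).1 (Function.isPeriodicPt_minimalPeriod f x))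

namespace Maniplex

variable {n : ℕ} {M : Maniplex.{u} n}

theorem mem_aut {γ : Equiv.Perm M.Flags} : γ ∈ M.aut ↔ ∀ i x, γ (M.r i x) = M.r i (γ x) := by
  rw [aut, Subgroup.mem_centralizer_iff, Set.forall_mem_range]
  exact forall_congr' fun i => Equiv.ext_iff.trans (forall_congr' fun x => eq_comm)

theorem aut_r (γ : M.aut) (i : Fin n) (x : M.Flags) : γ.1 (M.r i x) = M.r i (γ.1 x) :=
  mem_aut.1 γ.2 i x

theorem aut_ext {γ γ' : M.aut} {x : M.Flags} (h : γ.1 x = γ'.1 x) : γ = γ' := by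
  refine Subtype.ext (Equiv.ext fun y => ?_)
  induction M.linked_univ x y using Linked.induction with
  | refl => exact h
  | tail y _ i _ ih => rw [aut_r, aut_r, ih]

theorem mem_facetSet {x y : M.Flags} :
    y ∈ M.facetSet x ↔ Linked M.r {i | (i : ℕ) + 1 < n} x y := by
  rw [Linked.iff_exists_mem_closure M.involutive]
  simp only [facetSet, facetGroup, Set.image, Set.mem_ofPred_eq, eq_comm]

theorem image_facetSet (γ : M.aut) (x : M.Flags) : γ.1 '' M.facetSet x = M.facetSet (γ.1 x) := by
  ext y
  simp only [Set.mem_image, mem_facetSet]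
  constructor
  · rintro ⟨z, hz, rfl⟩
    exact hz.map γ.1 fun i _ => aut_r γ i
  · exact Linked.lift γ.1 fun i _ => aut_r γ i

/-- The action of an automorphism on the facets. -/
def facetMap (γ : M.aut) (F : M.Facet) : M.Facet :=
  ⟨γ.1 '' F.1, by
    obtain ⟨_, x, rfl⟩ := F
    exact ⟨γ.1 x, image_facetSet γ x⟩⟩

theorem facetMap_facetOf (γ : M.aut) (x : M.Flags) :
    facetMap γ (M.facetOf x) = M.facetOf (γ.1 x) :=
  Subtype.ext (image_facetSet γ x)

theorem facetMap_one : facetMap (1 : M.aut) = id :=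
  funext fun F => Subtype.ext (Set.image_id F.1)

theorem facetMap_mul (γ δ : M.aut) : facetMap (γ * δ) = facetMap γ ∘ facetMap δ :=
  funext fun F => Subtype.ext (Set.image_comp γ.1 δ.1 F.1)

variable (s : ℕ) (x₀ : M.Flags)

/-- The action of an automorphism on the vectors indexed by the facets. -/
noncomputable def vectorMap (γ : M.aut) : M.vectorGroup s →+ M.vectorGroup s :=
  ((Finsupp.mapDomain.addMonoidHom (facetMap γ)).comp (M.vectorGroup s).subtype).codRestrict _
    fun v => by
      have hv : Finsupp.liftAddHom (fun _ : M.Facet => AddMonoidHom.id (ZMod s)) v.1 = 0 := v.2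
      change Finsupp.liftAddHom (fun _ : M.Facet => AddMonoidHom.id (ZMod s))
        (Finsupp.mapDomain (facetMap γ) v.1) = 0
      rw [← hv, Finsupp.liftAddHom_apply, Finsupp.liftAddHom_apply]
      exact Finsupp.sum_mapDomain_index (by simp) (by simp)

theorem coe_vectorMap (γ : M.aut) (v : M.vectorGroup s) :
    (vectorMap s γ v : M.Facet →₀ ZMod s) = Finsupp.mapDomain (facetMap γ) v := rfl

theorem vectorMap_one (v : M.vectorGroup s) : vectorMap s 1 v = v :=
  Subtype.ext (by rw [coe_vectorMap, facetMap_one, Finsupp.mapDomain_id])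

theorem vectorMap_mul (γ δ : M.aut) (v : M.vectorGroup s) :
    vectorMap s (γ * δ) v = vectorMap s γ (vectorMap s δ v) :=
  Subtype.ext (by
    rw [coe_vectorMap, coe_vectorMap, coe_vectorMap, facetMap_mul, Finsupp.mapDomain_comp])

theorem facetVector_base : M.facetVector x₀ s (M.facetOf x₀) = 0 :=
  Subtype.ext (by simp [facetVector])

theorem vectorMap_facetVector (γ : M.aut) (x : M.Flags) :
    vectorMap s γ (M.facetVector x₀ s (M.facetOf x)) =
      M.facetVector x₀ s (M.facetOf (γ.1 x)) - M.facetVector x₀ s (M.facetOf (γ.1 x₀)) := by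
  apply Subtype.ext
  rw [coe_vectorMap]
  simp only [facetVector, AddSubgroupClass.coe_sub, sub_sub_sub_cancel_right]
  rw [← Finsupp.mapDomain.addMonoidHom_apply, map_sub]
  simp [facetMap_facetOf]

theorem twoS_r_castSucc (i : Fin n) (x : M.Flags) (v : M.vectorGroup s) (d : Bool) :
    (M.twoS x₀ s).r i.castSucc ((x, v, d) : M.TwoSFlags s) = ((M.r i x, v, d) : M.TwoSFlags s) := by
  change M.twoSPerm x₀ s i.castSucc (x, v, d) = _
  simp

theorem twoS_r_last (x : M.Flags) (v : M.vectorGroup s) (d : Bool) :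
    (M.twoS x₀ s).r (Fin.last n) ((x, v, d) : M.TwoSFlags s) =
      ((x, (if d = true then v - M.facetVector x₀ s (M.facetOf x)
        else v + M.facetVector x₀ s (M.facetOf x)), !d) : M.TwoSFlags s) := by
  change M.twoSPerm x₀ s (Fin.last n) (x, v, d) = _
  simp

theorem mem_aut_twoS {γ : Equiv.Perm (M.TwoSFlags s)}
    (hlower : ∀ i x v d, γ (M.twoSLower s i (x, v, d)) = M.twoSLower s i (γ (x, v, d)))
    (hlast : ∀ x v d, γ (M.twoSLast x₀ s (x, v, d)) = M.twoSLast x₀ s (γ (x, v, d))) :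
    γ ∈ (M.twoS x₀ s).aut := by
  refine mem_aut.2 ?_
  rintro i ⟨x, v, d⟩
  change γ (M.twoSPerm x₀ s i (x, v, d)) = M.twoSPerm x₀ s i (γ (x, v, d))
  induction i using Fin.lastCases with
  | last => simpa only [twoSPerm_last] using hlast x v d
  | cast i => simpa only [twoSPerm_castSucc] using hlower i x v d

/-- The map of the flags of `2s^(M - 1)` induced by an automorphism of `M`. The correction term
accounts for the base facet being moved: `γ a_j = a_{γ j} - a_{γ 0}`. -/
noncomputable def twoSMap (γ : M.aut) (z : M.TwoSFlags s) : M.TwoSFlags s :=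
  (γ.1 z.1, vectorMap s γ z.2.1 +
    (if z.2.2 = true then M.facetVector x₀ s (M.facetOf (γ.1 x₀)) else 0), z.2.2)

theorem twoSMap_one (z : M.TwoSFlags s) : twoSMap s x₀ 1 z = z := by
  obtain ⟨x, v, d⟩ := z
  cases d <;> simp [twoSMap, vectorMap_one, facetVector_base]

theorem twoSMap_mul (γ δ : M.aut) (z : M.TwoSFlags s) :
    twoSMap s x₀ (γ * δ) z = twoSMap s x₀ γ (twoSMap s x₀ δ z) := by
  obtain ⟨x, v, d⟩ := z
  cases d
  · simp [twoSMap, vectorMap_mul]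
  · simp [twoSMap, vectorMap_mul, vectorMap_facetVector, add_assoc]

/-- The permutation of the flags of `2s^(M - 1)` induced by an automorphism of `M`. -/
noncomputable def twoSMapPerm (γ : M.aut) : Equiv.Perm (M.TwoSFlags s) where
  toFun := twoSMap s x₀ γ
  invFun := twoSMap s x₀ γ⁻¹
  left_inv z := by rw [← twoSMap_mul, inv_mul_cancel, twoSMap_one]
  right_inv z := by rw [← twoSMap_mul, mul_inv_cancel, twoSMap_one]

theorem twoSMapPerm_apply (γ : M.aut) (z : M.TwoSFlags s) :
    twoSMapPerm s x₀ γ z = twoSMap s x₀ γ z := rfl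

/-- The automorphism of `2s^(M - 1)` induced by an automorphism of `M`. -/
noncomputable def twoSLift (γ : M.aut) : (M.twoS x₀ s).aut :=
  ⟨twoSMapPerm s x₀ γ, mem_aut_twoS s x₀
    (fun i x v d => by simp [twoSMapPerm_apply, twoSMap, aut_r])
    fun x v d => by
      cases d <;> simp [twoSMapPerm_apply, twoSMap, vectorMap_facetVector] <;> abel⟩

theorem twoSLift_base (γ : M.aut) : (twoSLift s x₀ γ).1 (M.twoSBase x₀ s) =
    ((γ.1 x₀, 0, false) : M.TwoSFlags s) := by
  change twoSMap s x₀ γ (x₀, 0, false) = _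
  simp [twoSMap]

/-- The negation of vectors, as a permutation of the flags of `2s^(M - 1)`. -/
noncomputable def twoSFlipPerm : Equiv.Perm (M.TwoSFlags s) :=
  Function.Involutive.toPerm (fun z : M.TwoSFlags s => (z.1, -z.2.1, !z.2.2)) fun z => by simp

theorem twoSFlipPerm_apply (x : M.Flags) (v : M.vectorGroup s) (d : Bool) :
    twoSFlipPerm s (x, v, d) = (x, -v, !d) := rfl

/-- The automorphism of `2s^(M - 1)` that negates the vectors. -/
noncomputable def twoSFlip : (M.twoS x₀ s).aut :=
  ⟨twoSFlipPerm s, mem_aut_twoS s x₀ (fun i x v d => rfl) fun x v d => by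
    cases d <;> simp [twoSFlipPerm_apply] <;> abel⟩

theorem twoSFlip_apply (x : M.Flags) (v : M.vectorGroup s) (d : Bool) :
    (twoSFlip s x₀).1 ((x, v, d) : M.TwoSFlags s) = ((x, -v, !d) : M.TwoSFlags s) := rfl

theorem exists_twoS_abstractRotation (hM : M.IsRegular) {i : ℕ} (h1 : 1 ≤ i) (h2 : i ≤ n) :
    ∃ γ : (M.twoS x₀ s).aut, (M.twoS x₀ s).IsAbstractRotation (M.twoSBase x₀ s) i γ := by
  obtain ⟨a, rfl⟩ : ∃ a : Fin n, i = a + 1 := ⟨⟨i - 1, by omega⟩, by grind⟩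
  have hlift : ∀ y, ∃ γ : (M.twoS x₀ s).aut,
      γ.1 (M.twoSBase x₀ s) = ((y, 0, false) : M.TwoSFlags s) := by
    intro y
    obtain ⟨γ, hγ, rfl⟩ := hM x₀ y
    exact ⟨twoSLift s x₀ ⟨γ, hγ⟩, twoSLift_base s x₀ ⟨γ, hγ⟩⟩
  by_cases ha : (a : ℕ) + 1 < n
  · obtain ⟨γ, hγ⟩ := hlift (M.r a (M.r ⟨a + 1, ha⟩ x₀))
    refine ⟨γ, a.castSucc, (⟨a + 1, ha⟩ : Fin n).castSucc, rfl, rfl, hγ.trans ?_⟩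
    rw [twoSBase, twoS_r_castSucc, twoS_r_castSucc]
  · obtain ⟨γ, hγ⟩ := hlift (M.r a x₀)
    refine ⟨twoSFlip s x₀ * γ, a.castSucc, Fin.last n, rfl, by grind, ?_⟩
    refine (congrArg (twoSFlip s x₀).1 hγ).trans ?_
    rw [twoSFlip_apply, twoSBase, twoS_r_last, twoS_r_castSucc]
    simp [facetVector_base]
    rfl

theorem facetOf_r_ne (hM : M.IsRegular) (hne : Nontrivial M.Facet) {l : Fin n}
    (hl : (l : ℕ) + 1 = n) (x : M.Flags) : M.facetOf (M.r l x) ≠ M.facetOf x := by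
  intro e
  have hall : ∀ y, M.facetOf (M.r l y) = M.facetOf y := by
    intro y
    obtain ⟨γ, hγ, rfl⟩ := hM x y
    have := congrArg (facetMap ⟨γ, hγ⟩) e
    rwa [facetMap_facetOf, facetMap_facetOf, aut_r] at this
  have hconst : ∀ y, M.facetOf y = M.facetOf x := fun y =>
    Linked.eq_of_invariant M.facetOf (fun i _ z => by
      by_cases hi : (i : ℕ) + 1 < n
      · exact M.facetOf_r i hi z
      · obtain rfl : i = l := Fin.ext (by omega)
        exact hall z) (M.linked_univ x y)
  obtain ⟨⟨_, y, rfl⟩, ⟨_, z, rfl⟩, hyz⟩ := hne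
  exact hyz ((hconst y).trans (hconst z).symm)

theorem nsmul_facetVector_sub_eq_zero_iff {x y : M.Flags} (hxy : M.facetOf y ≠ M.facetOf x)
    (k : ℕ) :
    k • (M.facetVector x₀ s (M.facetOf x) - M.facetVector x₀ s (M.facetOf y)) = 0 ↔ s ∣ k := by
  rw [← ZMod.natCast_eq_zero_iff, ← ZeroMemClass.coe_eq_zero]
  have hcoe : ((k • (M.facetVector x₀ s (M.facetOf x) - M.facetVector x₀ s (M.facetOf y)) :
      M.vectorGroup s) : M.Facet →₀ ZMod s) =
      Finsupp.single (M.facetOf x) (k : ZMod s) - Finsupp.single (M.facetOf y) (k : ZMod s) := by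
    simp [facetVector, smul_sub]
  rw [hcoe]
  exact ⟨fun h => by simpa [hxy] using DFunLike.congr_fun h (M.facetOf x),
    fun h => by rw [h]; simp⟩

theorem twoS_iterate_two_mul (l : Fin n) (x : M.Flags) (d : Bool) (k : ℕ) (v : M.vectorGroup s) :
    (fun w => M.twoSLower s l (M.twoSLast x₀ s w))^[2 * k] (x, v, d) =
      (x, v + (if d = true then -k else k : ℤ) •
        (M.facetVector x₀ s (M.facetOf x) - M.facetVector x₀ s (M.facetOf (M.r l x))), d) := by
  induction k with
  | zero => simp
  | succ k ih =>
    rw [mul_add, mul_one, add_comm, Function.iterate_add_apply, ih]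
    simp only [Function.iterate_succ, Function.iterate_zero, Function.comp_apply, id,
      twoSLast_apply, twoSLower_apply, M.involutive, Bool.not_not]
    cases d <;> simp only [Bool.not_true, Bool.not_false, if_true, if_false, Bool.false_eq_true,
      Prod.mk.injEq, true_and, and_true] <;> push_cast <;> module

theorem minimalPeriod_twoS (hM : M.IsRegular) (hne : Nontrivial M.Facet) {l : Fin n}
    (hl : (l : ℕ) + 1 = n) (z : (M.twoS x₀ s).Flags) :
    Function.minimalPeriod (fun w => (M.twoS x₀ s).r l.castSucc ((M.twoS x₀ s).r (Fin.last n) w))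
      z = 2 * s := by
  obtain ⟨x, v, d⟩ := z
  have hf : (fun w => (M.twoS x₀ s).r l.castSucc ((M.twoS x₀ s).r (Fin.last n) w)) =
      fun w : M.TwoSFlags s => M.twoSLower s l (M.twoSLast x₀ s w) := by
    simp only [← twoSPerm_castSucc M x₀, ← twoSPerm_last]
    rfl
  have hk0 := nsmul_facetVector_sub_eq_zero_iff s x₀ (facetOf_r_ne hM hne hl x)
  rw [hf]
  refine minimalPeriod_eq_of_forall_dvd fun m => ?_
  rcases Nat.even_or_odd' m with ⟨k, rfl | rfl⟩
  · rw [Nat.mul_dvd_mul_iff_left two_pos, ← hk0]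
    change _^[2 * k] (x, v, d) = (x, v, d) ↔ _
    rw [twoS_iterate_two_mul]
    cases d <;> simp
  · change _^[2 * k + 1] (x, v, d) = (x, v, d) ↔ _
    rw [Function.iterate_succ_apply', twoS_iterate_two_mul]
    simp only [twoSLast_apply, twoSLower_apply, Prod.mk.injEq, Bool.not_ne_self, and_false,
      false_iff]
    exact fun h => by have := (dvd_mul_right 2 s).trans h; omega

end Maniplex

/-! ### The mix of two maniplexes -/

namespace Maniplex

variable {n : ℕ} {M₁ M₂ : Maniplex.{u} n}

/-- The simultaneous action of the adjacency permutations on pairs of flags. -/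
def prodPerm (M₁ M₂ : Maniplex.{u} n) (i : Fin n) : Equiv.Perm (M₁.Flags × M₂.Flags) :=
  Equiv.prodCongr (M₁.r i) (M₂.r i)

theorem prodPerm_involutive (i : Fin n) : Function.Involutive (prodPerm M₁ M₂ i) := fun w =>
  Prod.ext (M₁.involutive i w.1) (M₂.involutive i w.2)

theorem linked_prodPerm_map (g : M₁.aut × M₂.aut) {I : Set (Fin n)} {w w' : M₁.Flags × M₂.Flags}
    (h : Linked (prodPerm M₁ M₂) I w w') :
    Linked (prodPerm M₁ M₂) I (g.1.1 w.1, g.2.1 w.2) (g.1.1 w'.1, g.2.1 w'.2) :=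
  h.map (fun w => (g.1.1 w.1, g.2.1 w.2)) fun i _ w =>
    Prod.ext (aut_r g.1 i w.1) (aut_r g.2 i w.2)

/-- The flags of the mix: the pairs of flags reachable from the pair of base flags. -/
abbrev MixFlags (M₁ M₂ : Maniplex.{u} n) (a : M₁.Flags × M₂.Flags) : Type u :=
  {w : M₁.Flags × M₂.Flags // Linked (prodPerm M₁ M₂) Set.univ a w}

/-- The adjacency permutations of the mix. -/
def mixPerm (M₁ M₂ : Maniplex.{u} n) (a : M₁.Flags × M₂.Flags) (i : Fin n) :
    Equiv.Perm (MixFlags M₁ M₂ a) :=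
  Function.Involutive.toPerm (fun w => ⟨prodPerm M₁ M₂ i w.1, w.2.tail (Set.mem_univ i)⟩)
    fun w => Subtype.ext (prodPerm_involutive i w.1)

theorem mixPerm_involutive (a : M₁.Flags × M₂.Flags) (i : Fin n) :
    Function.Involutive (mixPerm M₁ M₂ a i) := fun w => Subtype.ext (prodPerm_involutive i w.1)

theorem linked_mixPerm (a : M₁.Flags × M₂.Flags) (w : MixFlags M₁ M₂ a) :
    Linked (mixPerm M₁ M₂ a) Set.univ ⟨a, Linked.refl a⟩ w := by
  obtain ⟨w, hw⟩ := w
  induction hw using Linked.induction with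
  | refl => exact Linked.refl _
  | tail w hw i hi ih => exact ih.tail (i := i) hi

/-- The mix of two maniplexes with respect to base flags. -/
def mix (M₁ M₂ : Maniplex.{u} n) (a : M₁.Flags × M₂.Flags) : Maniplex.{u} n where
  Flags := MixFlags M₁ M₂ a
  r := mixPerm M₁ M₂ a
  nonempty := ⟨⟨a, Linked.refl a⟩⟩
  involutive := mixPerm_involutive a
  fixed_point_free i w e :=
    M₁.fixed_point_free i w.1.1 (congrArg (fun z : MixFlags M₁ M₂ a => z.1.1) e)
  distinct i j w hij e :=
    M₁.distinct i j w.1.1 hij (congrArg (fun z : MixFlags M₁ M₂ a => z.1.1) e)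
  squares i j hij w := Subtype.ext (Prod.ext (M₁.squares i j hij w.1.1) (M₂.squares i j hij w.1.2))
  connected x y := by
    rw [← Set.image_univ, ← Linked.iff_exists_mem_closure (mixPerm_involutive a)]
    exact ((linked_mixPerm a x).symm (mixPerm_involutive a)).trans (linked_mixPerm a y)

/-- The base flag of the mix. -/
def mixBase (M₁ M₂ : Maniplex.{u} n) (a : M₁.Flags × M₂.Flags) : (mix M₁ M₂ a).Flags :=
  (⟨a, Linked.refl a⟩ : MixFlags M₁ M₂ a)

/-- The pairs of automorphisms that map the mix to itself. -/
def mixGroup (a : M₁.Flags × M₂.Flags) : Subgroup (M₁.aut × M₂.aut) where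
  carrier := {g | Linked (prodPerm M₁ M₂) Set.univ a (g.1.1 a.1, g.2.1 a.2)}
  one_mem' := Linked.refl a
  mul_mem' {g h} hg hh := Linked.trans hg (linked_prodPerm_map g hh)
  inv_mem' {g} hg := by
    simpa using (linked_prodPerm_map g⁻¹ hg).symm prodPerm_involutive

/-- The action on the mix of a pair of automorphisms. -/
def mixMap {a : M₁.Flags × M₂.Flags} (g : mixGroup a) (w : MixFlags M₁ M₂ a) :
    MixFlags M₁ M₂ a :=
  ⟨(g.1.1.1 w.1.1, g.1.2.1 w.1.2), Linked.trans g.2 (linked_prodPerm_map g.1 w.2)⟩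

/-- The action on the mix of the pairs of automorphisms that map the mix to itself. -/
def mixHom (a : M₁.Flags × M₂.Flags) : mixGroup a →* (mix M₁ M₂ a).aut where
  toFun g := ⟨
    { toFun := mixMap g
      invFun := mixMap g⁻¹
      left_inv := fun _ => Subtype.ext (Prod.ext
        (Equiv.symm_apply_apply g.1.1.1 _) (Equiv.symm_apply_apply g.1.2.1 _))
      right_inv := fun _ => Subtype.ext (Prod.ext
        (Equiv.apply_symm_apply g.1.1.1 _) (Equiv.apply_symm_apply g.1.2.1 _)) },
    mem_aut.2 fun i _ => Subtype.ext (Prod.ext (aut_r g.1.1 i _) (aut_r g.1.2 i _))⟩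
  map_one' := rfl
  map_mul' _ _ := rfl

/-! ### Automorphisms of the poset of a maniplex -/

variable {M : Maniplex.{u} n}

/-- The action of an automorphism on the faces. -/
def posetMap (γ : M.aut) : M.Poset →o M.Poset :=
  OrderHom.antisymmetrization
    { toFun := fun F : M.PreFace => (⟨F.ht, γ.1 F.flag⟩ : M.PreFace)
      monotone' := by
        rintro ⟨k, x⟩ ⟨l, y⟩ ⟨hkl, z, hxz, hzy⟩
        exact ⟨hkl, γ.1 z, hxz.map _ fun i _ => aut_r γ i, hzy.map _ fun i _ => aut_r γ i⟩ }

theorem posetMap_mul_apply (γ δ : M.aut) (F : M.Poset) :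
    posetMap (γ * δ) F = posetMap γ (posetMap δ F) := by
  obtain ⟨k, x, rfl⟩ := exists_eq_mkFace F
  rfl

theorem posetMap_one_apply (F : M.Poset) : posetMap 1 F = F := by
  obtain ⟨k, x, rfl⟩ := exists_eq_mkFace F
  rfl

/-- The action of the automorphism group of a maniplex on its poset. -/
def posetHom (M : Maniplex.{u} n) : M.aut →* (M.Poset ≃o M.Poset) where
  toFun γ := OrderIso.ofHomInv (posetMap γ) (posetMap γ⁻¹)
    (OrderHom.ext _ _ (funext fun F => by
      change posetMap γ (posetMap γ⁻¹ F) = F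
      rw [← posetMap_mul_apply, mul_inv_cancel, posetMap_one_apply]))
    (OrderHom.ext _ _ (funext fun F => by
      change posetMap γ⁻¹ (posetMap γ F) = F
      rw [← posetMap_mul_apply, inv_mul_cancel, posetMap_one_apply]))
  map_one' := RelIso.ext posetMap_one_apply
  map_mul' γ δ := RelIso.ext (posetMap_mul_apply γ δ)

theorem map_posetHom_flagOf (γ : M.aut) (x : M.Flags) :
    Flag.map (posetHom M γ) (flagOf x) = flagOf (γ.1 x) := by
  refine (flag_eq_of_subset ?_).symm
  rintro _ ⟨k, rfl⟩
  exact ⟨M.mkFace k x, ⟨k, rfl⟩, rfl⟩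

end Maniplex

/-- The action of the automorphism group of a polytope on its flag graph. -/
noncomputable def IsPolytope.autHom {N : ℕ} {α : Type u} [PartialOrder α] [BoundedOrder α]
    (h : IsPolytope N α) : (α ≃o α) →* h.flagManiplex.aut where
  toFun e := ⟨Flag.map e, Maniplex.mem_aut.2 fun i Φ => h.map_adj h e i Φ⟩
  map_one' := Subtype.ext (Equiv.ext fun _ => Flag.ext (Set.image_id _))
  map_mul' e e' := Subtype.ext (Equiv.ext fun Φ : Flag α => Flag.ext (Set.image_comp e e' Φ))

/-! ### Facets as sections -/

theorem faceRank_Iic {α : Type u} [PartialOrder α] {F : α} (G : Set.Iic F) :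
    faceRank G = faceRank (G : α) := by
  rw [faceRank, faceRank]
  congr 3
  exact Order.height_eq_of_strictMono _ (Subtype.strictMono_coe _)
    (fun a b hb => ⟨⟨b, hb.le.trans a.2⟩, hb, rfl⟩) G

/-- The flag of the section below `F` given by a flag through `F`. -/
def flagRestrictIic {α : Type*} [PartialOrder α] (Φ : Flag α) {F : α} (hF : F ∈ Φ) :
    Flag (Set.Iic F) where
  carrier := {G | (G : α) ∈ Φ}
  Chain' _ hG _ hH _ := Φ.le_or_le hG hH
  max_chain' t ht hsub := hsub.antisymm fun G hG => Flag.mem_iff_forall_le_or_ge.2 fun H hH => by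
    rcases Φ.le_or_le hH hF with hle | hle
    · exact ht.total hG (hsub (show (⟨H, hle⟩ : Set.Iic F) ∈ {G : Set.Iic F | (G : α) ∈ Φ} from hH))
    · exact Or.inl (le_trans G.2 hle)

namespace IsPolytope

variable {N : ℕ} {α : Type u} [PartialOrder α] [BoundedOrder α] (h : IsPolytope N α)
include h

theorem flagAdj_flagRestrictIic {F : α} {i : ℤ} (hi : i < faceRank F) {Φ Ψ : Flag α}
    (hΦ : F ∈ Φ) (hΨ : F ∈ Ψ) (hadj : FlagAdj i Φ Ψ) :
    FlagAdj i (flagRestrictIic Φ hΦ) (flagRestrictIic Ψ hΨ) := by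
  refine ⟨fun e => hadj.1 (flag_eq_of_subset fun G hG => ?_), fun G hG => ?_⟩
  · by_cases hGi : faceRank G = i
    · rcases Φ.le_or_le hG hΦ with hle | hle
      · have hmem : (⟨G, hle⟩ : Set.Iic F) ∈ flagRestrictIic Φ hΦ := hG
        rwa [e] at hmem
      · have := h.faceRank_strictMono.monotone hle
        omega
    · exact (hadj.2 G hGi).1 hG
  · exact hadj.2 _ (by rwa [faceRank_Iic] at hG)

theorem le_of_face_le_face {Φ Ψ : Flag α} {k l : Fin (N + 2)} (hle : h.face Φ k ≤ h.face Ψ l) :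
    k ≤ l := by
  have := h.faceRank_strictMono.monotone hle
  rw [h.faceRank_face, h.faceRank_face] at this
  rw [Fin.le_def]
  omega

theorem linked_compl_of_face_eq {j : Fin N} {Φ Ψ : Flag α}
    (hj : h.face Φ j.succ.castSucc = h.face Ψ j.succ.castSucc) :
    Linked h.flagManiplex.r {j}ᶜ Φ Ψ :=
  h.linked_adjPerm fun m hm => by
    obtain rfl : m = j := not_not.1 hm
    exact hj

end IsPolytope

/-- Regularity of `R` lets the covering of the facet take a prescribed value at one flag. -/
theorem exists_facet_cover {n : ℕ} {K P : Type u} [PartialOrder K] [PartialOrder P]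
    [BoundedOrder P] (hP : IsPolytope (n + 1) P) (hPext : IsExtension n K P) {R : Maniplex.{u} n}
    (hKR : PolytopeCovers K R) (hR : R.IsRegular) (Φ : Flag P) (x : R.Flags) :
    ∃ ψ : Flag P → R.Flags, ψ Φ = x ∧ ∀ Ψ : Flag P,
      hP.face Ψ (Fin.last n).succ.castSucc = hP.face Φ (Fin.last n).succ.castSucc →
        ∀ i : Fin n, ψ (hP.adj i.castSucc Ψ) = R.r i (ψ Ψ) := by
  classical
  obtain ⟨φ, -, hφ⟩ := hKR
  set F := hP.face Φ (Fin.last n).succ.castSucc with hF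
  have hrank : faceRank F = (n : ℤ) := by rw [hF, hP.faceRank_face]; simp
  obtain ⟨e⟩ := hPext F hrank
  have hmem : ∀ Ψ : Flag P, hP.face Ψ (Fin.last n).succ.castSucc = F → F ∈ Ψ := fun Ψ h =>
    h ▸ hP.face_mem _ _
  let ψ : Flag P → R.Flags := fun Ψ =>
    if h : F ∈ Ψ then φ (Flag.map e (flagRestrictIic Ψ h)) else x
  obtain ⟨γ, hγ, hγx⟩ := hR (ψ Φ) x
  refine ⟨fun Ψ => γ (ψ Ψ), hγx, fun Ψ hΨ i => ?_⟩
  have hΨF := hmem Ψ hΨ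
  have hadjF : F ∈ hP.adj i.castSucc Ψ := hmem _ (by rw [hP.face_adj, hΨ]; grind)
  have hadj := hP.flagAdj_flagRestrictIic (by rw [hrank]; simp) hΨF hadjF
    (hP.flagAdj_adj i.castSucc Ψ)
  simp only [ψ, dif_pos hΨF, dif_pos hadjF, hφ i _ _ (hadj.map e)]
  exact Maniplex.mem_aut.1 hγ i _

/-! ### Facets of a maniplex covering a polytope -/

namespace Maniplex

section Cover

variable {n : ℕ} {M : Maniplex.{u} (n + 1)}

theorem linked_of_facet_eq {x y : M.Flags}
    (h : M.mkFace (Fin.last n).succ.castSucc x = M.mkFace (Fin.last n).succ.castSucc y) :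
    Linked M.r {Fin.last n}ᶜ x y :=
  (mkFace_eq_mkFace.1 h).2.mono fun i hi => by
    rintro rfl
    simp at hi

theorem exists_mkFace_of_le_facet {F : M.Poset} {x : M.Flags}
    (h : F ≤ M.mkFace (Fin.last n).succ.castSucc x) :
    ∃ k y, F = M.mkFace k y ∧ k ≤ (Fin.last n).succ.castSucc ∧ Linked M.r {Fin.last n}ᶜ x y := by
  obtain ⟨k, w, rfl⟩ := exists_eq_mkFace F
  obtain ⟨hk, y, hyw, hyx⟩ := mkFace_le_mkFace_iff_exists.1 h
  exact ⟨k, y, hyw.symm, hk, linked_of_facet_eq hyx.symm⟩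

variable {P : Type u} [PartialOrder P] [BoundedOrder P] (hP : IsPolytope (n + 1) P)
  (f : M.Flags → Flag P)

/-- The map on faces given by a map on flags. -/
noncomputable def coverFace (F : M.Poset) : P :=
  hP.face (f (ofAntisymmetrization (· ≤ ·) F : M.PreFace).flag)
    (ofAntisymmetrization (· ≤ ·) F : M.PreFace).ht

variable {f} (hf : ∀ i x, f (M.r i x) = hP.adj i (f x))
include hf

theorem face_eq_of_mkFace_eq {k : Fin (n + 3)} {x y : M.Flags} (h : M.mkFace k x = M.mkFace k y) :
    hP.face (f x) k = hP.face (f y) k :=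
  (hP.face_eq_of_linked
    ((mkFace_eq_mkFace.1 h).2.map (r' := hP.flagManiplex.r) f fun i _ => hf i)
      fun _ hi => hi).symm

theorem coverFace_mkFace (k : Fin (n + 3)) (x : M.Flags) :
    coverFace hP f (M.mkFace k x) = hP.face (f x) k := by
  set a : M.PreFace := ofAntisymmetrization (· ≤ ·) (M.mkFace k x) with ha
  have h : M.mkFace a.ht a.flag = M.mkFace k x :=
    toAntisymmetrization_ofAntisymmetrization (α := M.PreFace) (· ≤ ·) (M.mkFace k x)
  obtain ⟨k', y⟩ := a
  obtain rfl : k' = k := (mkFace_eq_mkFace.1 h).1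
  rw [coverFace, ← ha]
  exact face_eq_of_mkFace_eq hP hf h

theorem coverFace_mono : Monotone (coverFace hP f) := by
  intro F G h
  obtain ⟨k, x, rfl⟩ := exists_eq_mkFace F
  obtain ⟨l, y, rfl⟩ := exists_eq_mkFace G
  obtain ⟨hkl, z, hzx, hzy⟩ := mkFace_le_mkFace_iff_exists.1 h
  rw [← hzx, ← hzy, coverFace_mkFace hP hf, coverFace_mkFace hP hf]
  exact hP.face_le_face_iff.2 hkl

theorem exists_lift_of_facet_mem {x : M.Flags} {Ω : Flag P}
    (hΩ : hP.face (f x) (Fin.last n).succ.castSucc ∈ Ω) :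
    ∃ y, Linked M.r {Fin.last n}ᶜ x y ∧ f y = Ω :=
  Linked.lift (r := M.r) f (fun i _ => hf i) (hP.linked_compl_of_face_eq (hP.face_mem_iff.1 hΩ))

theorem exists_coverFace_eq {x : M.Flags} {A : P}
    (hA : A ≤ hP.face (f x) (Fin.last n).succ.castSucc) :
    ∃ F ≤ M.mkFace (Fin.last n).succ.castSucc x, coverFace hP f F = A := by
  obtain ⟨Ω, hAΩ, hFΩ⟩ := Flag.exists_mem_mem hA
  obtain ⟨z, hz, rfl⟩ := exists_lift_of_facet_mem hP hf hFΩ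
  obtain ⟨k, rfl⟩ := hP.exists_eq_face hAΩ
  refine ⟨M.mkFace k z, ?_, coverFace_mkFace hP hf k z⟩
  rw [mkFace_eq_of_linked hz fun i hi e => hi (Fin.ext (Nat.add_right_cancel e))]
  exact mkFace_mono z (hP.le_of_face_le_face hA)

variable (hinj : ∀ x y, Linked M.r {Fin.last n}ᶜ x y → f x = f y → x = y)
include hinj

theorem mkFace_eq_of_face_eq {k : Fin (n + 3)} {x y : M.Flags}
    (hxy : Linked M.r {Fin.last n}ᶜ x y) (h : hP.face (f x) k = hP.face (f y) k) :
    M.mkFace k x = M.mkFace k y := by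
  have hfxy := hxy.map (r' := hP.flagManiplex.r) f fun i _ => hf i
  have hl : Linked hP.flagManiplex.r {j | (j : ℕ) + 1 ≠ k ∧ j ≠ Fin.last n} (f x) (f y) := by
    refine hP.linked_adjPerm fun j hj => ?_
    simp only [Set.mem_ofPred_eq, not_and_or, not_not] at hj
    rcases hj with hj | rfl
    · obtain rfl : k = j.succ.castSucc := Fin.ext (by simp [hj])
      exact h
    · refine (hP.face_eq_of_linked hfxy fun i hi e => hi (Fin.ext ?_)).symm
      simpa using e
  obtain ⟨z, hz, hzy⟩ := Linked.lift (r := M.r) f (fun i _ => hf i) hl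
  obtain rfl := hinj z y (((hz.mono fun i hi => hi.2).symm M.involutive).trans hxy) hzy
  exact mkFace_eq_of_linked hz fun i hi => hi.1

theorem mkFace_le_of_face_le {k l : Fin (n + 3)} {x y : M.Flags}
    (hxy : Linked M.r {Fin.last n}ᶜ x y) (h : hP.face (f x) k ≤ hP.face (f y) l)
    (hl : l ≤ (Fin.last n).succ.castSucc) : M.mkFace k x ≤ M.mkFace l y := by
  have hlF := (hP.face_le_face_iff (Φ := f y)).2 hl
  have hchain : IsChain (· ≤ ·)
      {hP.face (f x) k, hP.face (f y) l, hP.face (f y) (Fin.last n).succ.castSucc} := by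
    refine (IsChain.pair hlF).insert ?_
    rintro b (rfl | rfl) _
    exacts [Or.inl h, Or.inl (h.trans hlF)]
  obtain ⟨Ω, hΩ⟩ := hchain.exists_subset_flag
  obtain ⟨hkΩ, hlΩ, hFΩ⟩ : hP.face (f x) k ∈ Ω ∧ hP.face (f y) l ∈ Ω ∧
      hP.face (f y) (Fin.last n).succ.castSucc ∈ Ω := by
    simpa [Set.insert_subset_iff] using hΩ
  obtain ⟨z, hz, rfl⟩ := exists_lift_of_facet_mem hP hf hFΩ
  exact mkFace_le_mkFace_iff_exists.2 ⟨hP.le_of_face_le_face h, z,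
    (mkFace_eq_of_face_eq hP hf hinj (hxy.trans hz) (hP.face_mem_iff.1 hkΩ)).symm,
    (mkFace_eq_of_face_eq hP hf hinj hz (hP.face_mem_iff.1 hlΩ)).symm⟩

theorem coverFace_le_coverFace_iff {x : M.Flags} {F G : M.Poset}
    (hF : F ≤ M.mkFace (Fin.last n).succ.castSucc x)
    (hG : G ≤ M.mkFace (Fin.last n).succ.castSucc x) :
    coverFace hP f F ≤ coverFace hP f G ↔ F ≤ G := by
  refine ⟨fun h => ?_, fun h => coverFace_mono hP hf h⟩
  obtain ⟨k, y, rfl, -, hy⟩ := exists_mkFace_of_le_facet hF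
  obtain ⟨l, z, rfl, hl, hz⟩ := exists_mkFace_of_le_facet hG
  rw [coverFace_mkFace hP hf, coverFace_mkFace hP hf] at h
  exact mkFace_le_of_face_le hP hf hinj ((hy.symm M.involutive).trans hz) h hl

theorem nonempty_facet_orderIso (x : M.Flags) :
    Nonempty (Set.Iic (M.mkFace (Fin.last n).succ.castSucc x) ≃o
      Set.Iic (hP.face (f x) (Fin.last n).succ.castSucc)) := by
  let g : Set.Iic (M.mkFace (Fin.last n).succ.castSucc x) →
      Set.Iic (hP.face (f x) (Fin.last n).succ.castSucc) := fun F =>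
    ⟨coverFace hP f F, coverFace_mkFace hP hf (Fin.last n).succ.castSucc x ▸
      coverFace_mono hP hf F.2⟩
  refine ⟨RelIso.ofSurjective (OrderEmbedding.ofMapLEIff g fun F G =>
    coverFace_le_coverFace_iff hP hf hinj F.2 G.2) ?_⟩
  rintro ⟨A, hA⟩
  obtain ⟨F, hF, rfl⟩ := exists_coverFace_eq hP hf hA
  exact ⟨⟨F, hF⟩, rfl⟩

theorem isExtension_poset {K : Type u} [PartialOrder K] (hPext : IsExtension n K P) :
    IsExtension n K M.Poset := by
  intro F hF
  obtain ⟨k, x, rfl⟩ := exists_eq_mkFace F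
  rw [faceRank_mkFace] at hF
  obtain rfl : k = (Fin.last n).succ.castSucc := Fin.ext (by grind)
  obtain ⟨e⟩ := nonempty_facet_orderIso hP hf hinj x
  obtain ⟨e'⟩ := hPext (hP.face (f x) (Fin.last n).succ.castSucc) (by rw [hP.faceRank_face]; simp)
  exact ⟨e.trans e'⟩

end Cover

end Maniplex

/-! ### Regularity of sections -/

theorem exists_flagRestrictIic_eq {α : Type*} [PartialOrder α] {F : α} (Ω : Flag (Set.Iic F)) :
    ∃ (Φ : Flag α) (hF : F ∈ Φ), flagRestrictIic Φ hF = Ω := by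
  obtain ⟨Φ, hΦ⟩ := (Ω.chain_le.image (OrderEmbedding.subtype _)).exists_subset_flag
  have hF : F ∈ Φ := hΦ ⟨⟨F, le_rfl⟩, Ω.top_mem, rfl⟩
  refine ⟨Φ, hF, (flag_eq_of_subset fun G hG => ?_).symm⟩
  exact hΦ (Set.mem_image_of_mem (OrderEmbedding.subtype _) hG)

namespace IsRegularPolytope

variable {α β : Type u} [PartialOrder α] [PartialOrder β]

theorem of_orderIso (hα : IsRegularPolytope α) (e : α ≃o β) : IsRegularPolytope β := by
  intro Φ Ψ
  obtain ⟨γ, hγ⟩ := hα (Flag.map e.symm Φ) (Flag.map e.symm Ψ)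
  refine ⟨(e.symm.trans γ).trans e, ?_⟩
  calc Flag.map ((e.symm.trans γ).trans e) Φ
      = Flag.map e (Flag.map γ (Flag.map e.symm Φ)) := Flag.ext (by simp [Set.image_image])
    _ = Ψ := by rw [hγ]; exact (Flag.map e).apply_symm_apply Ψ

theorem iic [BoundedOrder α] {N : ℕ} (h : IsPolytope N α) (hα : IsRegularPolytope α) (F : α) :
    IsRegularPolytope (Set.Iic F) := by
  intro Ω Ω'
  obtain ⟨Φ, hΦ, rfl⟩ := exists_flagRestrictIic_eq Ω
  obtain ⟨Ψ, hΨ, rfl⟩ := exists_flagRestrictIic_eq Ω'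
  obtain ⟨γ, rfl⟩ := hα Φ Ψ
  have hγF : γ F = F := h.eq_of_mem (Set.mem_image_of_mem γ hΦ) hΨ (faceRank_orderIso γ F)
  let δ : Set.Iic F ≃o Set.Iic F :=
    { γ.toEquiv.subtypeEquiv fun G => by
        rw [Set.mem_Iic, Set.mem_Iic, ← γ.le_iff_le, hγF]; rfl with
      map_rel_iff' := γ.le_iff_le }
  refine ⟨δ, flag_eq_of_subset ?_⟩
  rintro _ ⟨G, hG, rfl⟩
  exact Set.mem_image_of_mem γ hG

end IsRegularPolytope

theorem IsExtension.isRegularPolytope {n : ℕ} {K Q : Type u} [PartialOrder K] [PartialOrder Q]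
    [BoundedOrder Q] (hQ : IsPolytope (n + 1) Q) (hext : IsExtension n K Q)
    (hreg : IsRegularPolytope Q) : IsRegularPolytope K := by
  obtain ⟨Ω, -⟩ := Flag.exists_mem (⊥ : Q)
  obtain ⟨e⟩ := hext (hQ.face Ω (Fin.last n).succ.castSucc) (by rw [hQ.faceRank_face]; simp)
  exact (hreg.iic hQ _).of_orderIso e

/-! ### Schläfli types of orientable polytopes -/

theorem zpow_apply_invariant {X β : Type*} {d : Equiv.Perm X} {f : X → β}
    (hf : ∀ x, f (d x) = f x) (k : ℤ) (x : X) : f ((d ^ k) x) = f x := by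
  induction k using Int.induction_on with
  | zero => rfl
  | succ k ih => rw [add_comm, zpow_add, zpow_one, Equiv.Perm.mul_apply, hf, ih]
  | pred k ih =>
    rw [← ih, ← hf ((d ^ (-(k : ℤ) - 1)) x), ← Equiv.Perm.mul_apply, ← zpow_one_add]
    congr 3
    ring

namespace Linked

variable {ι X : Type*} {r : ι → Equiv.Perm X} {i j : ι} {x y : X}

theorem exists_zpow (hr : ∀ i, Function.Involutive (r i)) (h : Linked r {i, j} x y) :
    ∃ k : ℤ, y = ((r i * r j) ^ k) x ∨ y = r j (((r i * r j) ^ k) x) := by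
  induction h using Linked.induction with
  | refl => exact ⟨0, Or.inl rfl⟩
  | tail y _ m hm ih =>
    obtain rfl | rfl := hm <;> obtain ⟨k, rfl | rfl⟩ := ih
    · refine ⟨k - 1, Or.inr ?_⟩
      have hk : (r m * r j) ^ k = r m * r j * (r m * r j) ^ (k - 1) := by
        rw [← zpow_one_add, add_sub_cancel]
      rw [hk, Equiv.Perm.mul_apply, Equiv.Perm.mul_apply, hr]
    · exact ⟨1 + k, Or.inl (by rw [zpow_one_add]; rfl)⟩
    · exact ⟨k, Or.inr rfl⟩
    · exact ⟨k, Or.inl (hr _ _)⟩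

theorem orbit_zpowers_eq (hr : ∀ i, Function.Involutive (r i)) {c : X → Bool}
    (hc : ∀ i x, c (r i x) = !c x) :
    MulAction.orbit (Subgroup.zpowers (r i * r j)) x = {y | Linked r {i, j} x y ∧ c y = c x} := by
  have hcol : ∀ k : ℤ, c (((r i * r j) ^ k) x) = c x := fun k =>
    zpow_apply_invariant (fun y => by rw [Equiv.Perm.mul_apply, hc, hc, Bool.not_not]) k x
  ext y
  constructor
  · rintro ⟨⟨_, k, rfl⟩, rfl⟩
    refine ⟨(iff_exists_mem_closure hr).2 ⟨_, zpow_mem (mul_mem ?_ ?_) k, rfl⟩, hcol k⟩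
    · exact Subgroup.subset_closure (Set.mem_image_of_mem r (by simp))
    · exact Subgroup.subset_closure (Set.mem_image_of_mem r (by simp))
  · rintro ⟨hy, hcy⟩
    obtain ⟨k, rfl | rfl⟩ := hy.exists_zpow hr
    · exact ⟨⟨_, k, rfl⟩, rfl⟩
    · rw [hc, hcol] at hcy
      exact absurd hcy (Bool.not_ne_self _)

end Linked

namespace IsPolytope

variable {n : ℕ} {α : Type u} [PartialOrder α] [BoundedOrder α] (h : IsPolytope (n + 1) α)
include h

theorem exists_linked_mem_of_between {Φ : Flag α} {l : Fin n} {H : α}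
    (hlow : h.face Φ l.castSucc.castSucc.castSucc ≤ H) (hhigh : H ≤ h.face Φ l.succ.succ.succ) :
    ∃ Ω, H ∈ Ω ∧ Linked h.adjPerm {l.castSucc, l.succ} Φ Ω := by
  have hchain : IsChain (· ≤ ·) (insert H {F | F ∈ Φ ∧
      (F ≤ h.face Φ l.castSucc.castSucc.castSucc ∨ h.face Φ l.succ.succ.succ ≤ F)}) := by
    refine (Φ.chain_le.mono fun F hF => hF.1).insert ?_
    rintro F ⟨-, hF | hF⟩ -
    exacts [Or.inr (hF.trans hlow), Or.inl (hhigh.trans hF)]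
  obtain ⟨Ω, hΩ⟩ := hchain.exists_subset_flag
  refine ⟨Ω, hΩ (Set.mem_insert _ _), h.linked_adjPerm fun j hj => h.face_mem_iff.1 (hΩ ?_)⟩
  refine Set.mem_insert_of_mem _ ⟨h.face_mem Φ _, ?_⟩
  rw [h.face_le_face_iff, h.face_le_face_iff, Fin.le_def, Fin.le_def]
  simp only [Set.mem_insert_iff, Set.mem_singleton_iff, Fin.ext_iff, not_or] at hj
  grind

variable {c : Flag α → Bool} (hc : IsFlagColouring c)
include hc

theorem injOn_face_linked (Φ : Flag α) (l : Fin n) :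
    Set.InjOn (fun Ψ => h.face Ψ l.castSucc.succ.castSucc)
      {Ψ | Linked h.adjPerm {l.castSucc, l.succ} Φ Ψ ∧ c Ψ = c Φ} := by
  rintro Ψ ⟨hΨ, hcΨ⟩ Ω ⟨hΩ, hcΩ⟩ hface
  have hlinked : Linked h.adjPerm {l.succ} Ψ Ω := h.linked_adjPerm fun j hj => by
    by_cases hjl : j = l.castSucc
    · rw [hjl]
      exact hface
    · have hinv : ∀ i ∈ ({l.castSucc, l.succ} : Set (Fin (n + 1))),
          (i : ℕ) + 1 ≠ (j.succ.castSucc : Fin (n + 3)) := by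
        rintro i (rfl | rfl) e
        exacts [hjl (Fin.ext (Nat.add_right_cancel e).symm),
          hj (Fin.ext (Nat.add_right_cancel e).symm)]
      rw [h.face_eq_of_linked hΨ hinv, h.face_eq_of_linked hΩ hinv]
  rcases hlinked.eq_or_eq_of_singleton (h.adj_involutive _) with rfl | rfl
  · rfl
  · have hne := h.isFlagColouring_iff.1 hc l.succ Ψ
    exact absurd (hne.symm.trans (hcΩ.trans hcΨ.symm)) (Bool.not_ne_self _)

theorem encard_section_face (Φ : Flag α) (l : Fin n) :
    {H : α | h.face Φ l.castSucc.castSucc.castSucc ≤ H ∧ H ≤ h.face Φ l.succ.succ.succ ∧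
      faceRank H = (l : ℕ)}.encard =
        ENat.card (ZMod (Function.minimalPeriod
          (fun Ψ => h.adj l.castSucc (h.adj l.succ Ψ)) Φ)) := by
  have hadj := h.isFlagColouring_iff.1 hc
  have hset : {H : α | h.face Φ l.castSucc.castSucc.castSucc ≤ H ∧
      H ≤ h.face Φ l.succ.succ.succ ∧ faceRank H = (l : ℕ)} =
      (fun Ψ => h.face Ψ l.castSucc.succ.castSucc) ''
        {Ψ | Linked h.adjPerm {l.castSucc, l.succ} Φ Ψ ∧ c Ψ = c Φ} := by
    ext H
    constructor
    · rintro ⟨hlow, hhigh, hH⟩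
      obtain ⟨Ω, hHΩ, hΩ⟩ := h.exists_linked_mem_of_between hlow hhigh
      have hHface : H = h.face Ω l.castSucc.succ.castSucc := h.eq_face hHΩ (by rw [hH]; simp)
      by_cases hcΩ : c Ω = c Φ
      · exact ⟨Ω, ⟨hΩ, hcΩ⟩, hHface.symm⟩
      · refine ⟨h.adj l.succ Ω, ⟨hΩ.tail (by simp), ?_⟩, ?_⟩
        · rw [hadj, Bool.eq_not_of_ne hcΩ, Bool.not_not]
        · exact (h.face_adj (by simp)).trans hHface.symm
    · rintro ⟨Ψ, ⟨hΨ, -⟩, rfl⟩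
      have hinv : ∀ k : Fin (n + 3), (k : ℕ) ≠ l + 1 → (k : ℕ) ≠ l + 2 →
          h.face Ψ k = h.face Φ k := fun k h1 h2 => h.face_eq_of_linked hΨ (by
        rintro i (rfl | rfl) e <;> grind)
      refine ⟨?_, ?_, by rw [h.faceRank_face]; simp⟩
      · rw [← hinv _ (by simp) (by simp), h.face_le_face_iff, Fin.le_def]
        simp
      · rw [← hinv _ (by grind) (by simp), h.face_le_face_iff, Fin.le_def]
        simp
  rw [hset, (h.injOn_face_linked hc Φ l).encard_image,
    ← Linked.orbit_zpowers_eq (r := h.adjPerm) h.adj_involutive hadj]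
  exact ENat.card_congr (MulAction.orbitZPowersEquiv (h.adjPerm l.castSucc * h.adjPerm l.succ) Φ)

theorem hasSchlafliType_iff {p : ℕ → ℕ∞} : HasSchlafliType (n + 1) α p ↔
    ∀ (l : Fin n) (Φ : Flag α), ENat.card (ZMod (Function.minimalPeriod
      (fun Ψ => h.adj l.castSucc (h.adj l.succ Ψ)) Φ)) = p (l + 1) := by
  constructor
  · intro hp l Φ
    have hle : h.face Φ l.castSucc.castSucc.castSucc ≤ h.face Φ l.succ.succ.succ :=
      h.face_le_face_iff.2 (by grind)
    rw [← h.encard_section_face hc, ← hp (l + 1) (by omega) (by omega) _ _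
      (by rw [h.faceRank_face]; grind) (by rw [h.faceRank_face]; simp) hle]
    simp
  · intro hp i h1 hi F G hF hG hFG
    obtain ⟨l, rfl⟩ : ∃ l : Fin n, i = l + 1 := ⟨⟨i - 1, by omega⟩, by grind⟩
    obtain ⟨Φ, hFΦ, hGΦ⟩ := Flag.exists_mem_mem hFG
    obtain rfl : F = h.face Φ l.castSucc.castSucc.castSucc :=
      h.eq_face hFΦ (by rw [hF]; grind)
    obtain rfl : G = h.face Φ l.succ.succ.succ := h.eq_face hGΦ (by rw [hG]; simp)
    rw [← hp l Φ, ← h.encard_section_face hc]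
    simp

end IsPolytope

/-! ### Rotations -/

namespace Maniplex

variable {n : ℕ} {M : Maniplex.{u} (n + 1)} {Γ : Subgroup M.aut} {x : M.Flags}
  (hΓ : ∀ i : Fin n, ∃ γ ∈ Γ, γ.1 x = M.r i.castSucc (M.r i.succ x))
include hΓ

theorem exists_apply_eq_r (i : Fin (n + 1)) : ∃ γ ∈ Γ, M.r i x = γ.1 (M.r 0 x) := by
  induction i using Fin.induction with
  | zero => exact ⟨1, one_mem _, rfl⟩
  | succ i ih =>
    obtain ⟨δ, hδ, hδx⟩ := ih
    obtain ⟨γ, hγ, hγx⟩ := hΓ i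
    refine ⟨γ * δ, mul_mem hγ hδ, ?_⟩
    rw [Subgroup.coe_mul, Equiv.Perm.mul_apply, ← hδx, aut_r, hγx, M.involutive]

theorem exists_apply_eq (y : M.Flags) : ∃ γ ∈ Γ, y = γ.1 x ∨ y = γ.1 (M.r 0 x) := by
  induction M.linked_univ x y using Linked.induction with
  | refl => exact ⟨1, one_mem _, Or.inl rfl⟩
  | tail y _ i _ ih =>
    obtain ⟨δ, hδ, hδx⟩ := exists_apply_eq_r hΓ i
    obtain ⟨γ, hγ, rfl | rfl⟩ := ih
    · refine ⟨γ * δ, mul_mem hγ hδ, Or.inr ?_⟩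
      rw [← aut_r, hδx]
      rfl
    · refine ⟨γ * δ⁻¹, mul_mem hγ (inv_mem hδ), Or.inl ?_⟩
      have hinv : M.r i (M.r 0 x) = (δ⁻¹ : M.aut).1 x := by
        refine Equiv.Perm.eq_inv_iff_eq.2 ?_
        rw [aut_r, ← hδx, M.involutive]
      rw [← aut_r, hinv]
      rfl

variable {c : M.Flags → Bool} (hc : ∀ i y, c (M.r i y) = !c y)
  (hΓc : ∀ γ ∈ Γ, ∀ y, c (γ.1 y) = c y)
include hc hΓc

theorem exists_apply_eq_of_colour_eq {y z : M.Flags} (h : c y = c z) : ∃ γ ∈ Γ, γ.1 y = z := by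
  have hquot : ∀ {γ δ : M.aut} (w : M.Flags), (δ * γ⁻¹).1 (γ.1 w) = δ.1 w := fun {γ δ} w =>
    congrArg δ.1 (Equiv.symm_apply_apply γ.1 w)
  obtain ⟨γ, hγ, hy⟩ := exists_apply_eq hΓ y
  obtain ⟨δ, hδ, hz⟩ := exists_apply_eq hΓ z
  refine ⟨δ * γ⁻¹, mul_mem hδ (inv_mem hγ), ?_⟩
  rcases hy with rfl | rfl <;> rcases hz with rfl | rfl
  · exact hquot x
  · rw [hΓc γ hγ, hΓc δ hδ, hc] at h
    exact absurd h.symm (Bool.not_ne_self _)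
  · rw [hΓc γ hγ, hΓc δ hδ, hc] at h
    exact absurd h (Bool.not_ne_self _)
  · exact hquot _

end Maniplex

namespace IsPolytope

variable {N : ℕ} {α : Type u} [PartialOrder α] [BoundedOrder α] (h : IsPolytope N α) {Φ : Flag α}
include h

theorem mem_rotationGroup_iff {c : Flag α → Bool} (hc : IsFlagColouring c) {γ : α ≃o α} :
    γ ∈ rotationGroup Φ ↔ ∀ Ψ, c (Flag.map γ Ψ) = c Ψ := by
  refine forall_congr' fun Ψ => ?_
  rw [h.mem_whiteFlags_iff hc, h.mem_whiteFlags_iff hc]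
  cases c (Flag.map γ Ψ) <;> cases c Ψ <;> cases c Φ <;> simp

theorem isAbstractRotation_iff {i : ℕ} {γ : α ≃o α} : IsAbstractRotation Φ i γ ↔
    ∃ a b : Fin N, (a : ℕ) + 1 = i ∧ (b : ℕ) = i ∧ Flag.map γ Φ = h.adj a (h.adj b Φ) := by
  constructor
  · rintro ⟨-, Φ₁, hb, ha⟩
    obtain ⟨b, hbi⟩ := h.exists_eq_of_flagAdj hb
    obtain ⟨a, hai⟩ := h.exists_eq_of_flagAdj ha
    rw [hbi] at hb
    rw [hai] at ha
    exact ⟨a, b, by omega, by omega, by rw [← h.flagAdj_iff.1 hb, ← h.flagAdj_iff.1 ha]⟩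
  · rintro ⟨a, b, rfl, hb, hγ⟩
    refine ⟨by omega, h.adj b Φ, hb ▸ h.flagAdj_adj b Φ, ?_⟩
    rw [hγ, Nat.cast_add, Nat.cast_one, add_sub_cancel_right]
    exact h.flagAdj_adj a (h.adj b Φ)

theorem exists_abstractRotation (hα : IsRotaryPolytope α) (Φ : Flag α) {a b : Fin N}
    (hab : (a : ℕ) + 1 = b) : ∃ γ : α ≃o α, IsAbstractRotation Φ b γ := by
  have hwhite : h.adj a (h.adj b Φ) ∈ whiteFlags Φ := fun c hc => by
    rw [h.isFlagColouring_iff] at hc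
    rw [hc, hc, Bool.not_not]
  obtain ⟨γ, -, hγ⟩ := hα Φ Φ (fun _ _ => rfl) _ hwhite
  exact ⟨γ, h.isAbstractRotation_iff.2 ⟨a, b, hab, rfl, hγ⟩⟩

theorem mem_rotationGroup_of_isAbstractRotation {c : Flag α → Bool} (hc : IsFlagColouring c)
    {i : ℕ} {γ : α ≃o α} (hγ : IsAbstractRotation Φ i γ) : γ ∈ rotationGroup Φ := by
  obtain ⟨a, b, -, -, hγ⟩ := h.isAbstractRotation_iff.1 hγ
  have hadj := h.isFlagColouring_iff.1 hc
  exact (h.mem_rotationGroup_iff hc).2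
    (h.comp_map_colouring hc (by rw [hγ, hadj, hadj, Bool.not_not]))

end IsPolytope

namespace Maniplex.IsPolytopal

variable {n : ℕ} {M : Maniplex.{u} n} (hM : M.IsPolytopal)
include hM

theorem adj_flagOf (i : Fin n) (x : M.Flags) :
    hM.isPolytope.adj i (flagOf x) = flagOf (M.r i x) :=
  (hM.isPolytope.flagAdj_iff.1 (hM.flagAdj_flagOf.2 rfl)).symm

theorem posetHom_injective : Function.Injective (posetHom M) := fun γ δ h => by
  obtain ⟨x⟩ := M.nonempty
  refine aut_ext (x := x) (hM.flagOf_injective ?_)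
  rw [← map_posetHom_flagOf, ← map_posetHom_flagOf, h]

theorem exists_isFlagColouring {c : M.Flags → Bool} (hc : ∀ i x, c (M.r i x) = !c x) :
    ∃ c' : Flag M.Poset → Bool, IsFlagColouring c' ∧ ∀ x, c' (flagOf x) = c x := by
  let e : M.Flags ≃ Flag M.Poset :=
    Equiv.ofBijective flagOf ⟨hM.flagOf_injective, flagOf_surjective⟩
  have he : ∀ x, c (e.symm (flagOf x)) = c x := fun x => congrArg c (e.symm_apply_apply x)
  refine ⟨c ∘ e.symm, hM.isPolytope.isFlagColouring_iff.2 fun i Ψ => ?_, he⟩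
  obtain ⟨x, rfl⟩ := flagOf_surjective Ψ
  simp only [Function.comp_apply, hM.adj_flagOf, he, hc]

end Maniplex.IsPolytopal

namespace Maniplex.IsPolytopal

variable {n : ℕ} {M : Maniplex.{u} (n + 1)} (hM : M.IsPolytopal) {c : M.Flags → Bool}
  (hc : ∀ i y, c (M.r i y) = !c y) {Γ : Subgroup M.aut} (hΓc : ∀ γ ∈ Γ, ∀ y, c (γ.1 y) = c y)
  {x : M.Flags} (hΓ : ∀ i : Fin n, ∃ γ ∈ Γ, γ.1 x = M.r i.castSucc (M.r i.succ x))
include hM hc hΓc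

theorem posetHom_mem_rotationGroup {γ : M.aut} (hγ : γ ∈ Γ) (Φ : Flag M.Poset) :
    posetHom M γ ∈ rotationGroup Φ := by
  obtain ⟨c', hc', hcolour⟩ := hM.exists_isFlagColouring hc
  refine (hM.isPolytope.mem_rotationGroup_iff hc').2 fun Ψ => ?_
  obtain ⟨y, rfl⟩ := flagOf_surjective Ψ
  rw [map_posetHom_flagOf, hcolour, hcolour, hΓc γ hγ]

include hΓ

theorem exists_map_posetHom_eq {Φ₀ Φ Ψ : Flag M.Poset} (hΦ : Φ ∈ whiteFlags Φ₀)
    (hΨ : Ψ ∈ whiteFlags Φ₀) : ∃ γ ∈ Γ, Flag.map (posetHom M γ) Φ = Ψ := by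
  obtain ⟨c', hc', hcolour⟩ := hM.exists_isFlagColouring hc
  rw [hM.isPolytope.mem_whiteFlags_iff hc'] at hΦ hΨ
  obtain ⟨y, rfl⟩ := flagOf_surjective Φ
  obtain ⟨z, rfl⟩ := flagOf_surjective Ψ
  rw [← hΨ, hcolour, hcolour] at hΦ
  obtain ⟨γ, hγ, rfl⟩ := exists_apply_eq_of_colour_eq hΓ hc hΓc hΦ
  exact ⟨γ, hγ, map_posetHom_flagOf γ y⟩

theorem isRotaryPolytope : IsRotaryPolytope M.Poset := by
  intro Φ₀ Φ hΦ Ψ hΨ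
  obtain ⟨γ, hγ, rfl⟩ := hM.exists_map_posetHom_eq hc hΓc hΓ hΦ hΨ
  exact ⟨posetHom M γ, hM.posetHom_mem_rotationGroup hc hΓc hγ Φ₀, rfl⟩

theorem rotationGroup_eq_map (Φ : Flag M.Poset) : rotationGroup Φ = Γ.map (posetHom M) := by
  ext γ
  constructor
  · intro hγ
    have hwhite : Φ ∈ whiteFlags Φ := fun _ _ => rfl
    obtain ⟨δ, hδ, hδΦ⟩ := hM.exists_map_posetHom_eq hc hΓc hΓ hwhite ((hγ Φ).2 hwhite)
    exact ⟨δ, hδ, hM.isPolytope.orderIso_ext hδΦ⟩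
  · rintro ⟨δ, hδ, rfl⟩
    exact hM.posetHom_mem_rotationGroup hc hΓc hδ Φ

end Maniplex.IsPolytopal

theorem Maniplex.IsPolytopal.exists_rotationGroup_mulEquiv {n : ℕ} {M : Maniplex.{u} (n + 1)}
    (hM : M.IsPolytopal) {c : M.Flags → Bool} (hc : ∀ i y, c (M.r i y) = !c y) {x : M.Flags}
    {G : Type*} [Group G] {θ : G →* M.aut} (hθ : Function.Injective θ)
    (hθc : ∀ g y, c ((θ g).1 y) = c y)
    (hθx : ∀ i : Fin n, ∃ g, (θ g).1 x = M.r i.castSucc (M.r i.succ x)) :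
    ∃ f : rotationGroup (flagOf x) ≃* G,
      ∀ γ, Flag.map γ.1 (flagOf x) = flagOf ((θ (f γ)).1 x) := by
  have hrange : rotationGroup (flagOf x) = ((posetHom M).comp θ).range := by
    rw [MonoidHom.range_comp]
    refine hM.rotationGroup_eq_map hc (Γ := θ.range) ?_ (x := x) (fun i => ?_) _
    · rintro _ ⟨g, rfl⟩ y
      exact hθc g y
    · obtain ⟨g, hg⟩ := hθx i
      exact ⟨_, ⟨g, rfl⟩, hg⟩
  have hinj : Function.Injective ((posetHom M).comp θ) := hM.posetHom_injective.comp hθ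
  refine ⟨(MulEquiv.subgroupCongr hrange).trans (MonoidHom.ofInjective hinj).symm, fun γ => ?_⟩
  rw [← map_posetHom_flagOf]
  exact congrArg (fun δ => Flag.map δ (flagOf x)) (congrArg Subtype.val
    ((MonoidHom.ofInjective hinj).apply_symm_apply (MulEquiv.subgroupCongr hrange γ))).symm

/-! ### The mix of the rotation groups -/

section RotationMix

open Maniplex

variable {n : ℕ} {P : Type u} [PartialOrder P] [BoundedOrder P]

section

variable (hP : IsPolytope n P) {T : Maniplex.{u} n} {Φ₀ : Flag P} {t : T.Flags}

theorem rotationMix_le_comap_mixGroup : rotationMix Φ₀ T t ≤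
    (mixGroup (M₁ := hP.flagManiplex) (Φ₀, t)).comap (hP.autHom.prodMap (MonoidHom.id T.aut)) := by
  rw [rotationMix, Subgroup.closure_le]
  rintro ⟨γ, δ⟩ ⟨i, hγ, ⟨j, k, rfl, hk, hδ⟩⟩
  obtain ⟨j', k', hj', hk', hγΦ⟩ := hP.isAbstractRotation_iff.1 hγ
  obtain rfl : j' = j := Fin.ext (by omega)
  obtain rfl : k' = k := Fin.ext (by omega)
  have hlinked := ((Linked.refl (r := prodPerm hP.flagManiplex T) (I := Set.univ) (Φ₀, t)).tail
    (Set.mem_univ k')).tail (Set.mem_univ j')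
  have hpair : prodPerm hP.flagManiplex T j' (prodPerm hP.flagManiplex T k' (Φ₀, t)) =
      (Flag.map γ Φ₀, δ.1 t) := Prod.ext hγΦ.symm hδ.symm
  rwa [hpair] at hlinked

/-- The action of the mix of the rotation groups on the mix of the flag graphs. -/
noncomputable def rotationMixHom : rotationMix Φ₀ T t →* (mix hP.flagManiplex T (Φ₀, t)).aut :=
  (mixHom _).comp (((hP.autHom.prodMap (MonoidHom.id T.aut)).comp
    (rotationMix Φ₀ T t).subtype).codRestrict _ fun g => rotationMix_le_comap_mixGroup hP g.2)

theorem rotationMixHom_injective :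
    Function.Injective (rotationMixHom hP (Φ₀ := Φ₀) (T := T) (t := t)) := by
  intro g g' hg
  have hbase : (Flag.map g.1.1 Φ₀, g.1.2.1 t) = (Flag.map g'.1.1 Φ₀, g'.1.2.1 t) :=
    congrArg Subtype.val (congrArg (fun γ : (mix hP.flagManiplex T (Φ₀, t)).aut =>
      γ.1 (mixBase hP.flagManiplex T (Φ₀, t))) hg)
  rw [Prod.ext_iff] at hbase
  exact Subtype.ext (Prod.ext (hP.orderIso_ext hbase.1) (aut_ext hbase.2))

theorem isAbstractRotation_of_rotationMixHom {g : rotationMix Φ₀ T t} {j k : Fin n}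
    (hjk : (j : ℕ) + 1 = k) (hg : (rotationMixHom hP g).1 (mixBase hP.flagManiplex T (Φ₀, t)) =
      (mix hP.flagManiplex T (Φ₀, t)).r j
        ((mix hP.flagManiplex T (Φ₀, t)).r k (mixBase hP.flagManiplex T (Φ₀, t)))) :
    IsAbstractRotation Φ₀ k g.1.1 ∧ T.IsAbstractRotation t k g.1.2 := by
  have hpair := Prod.ext_iff.1 (congrArg Subtype.val hg)
  exact ⟨hP.isAbstractRotation_iff.2 ⟨j, k, hjk, rfl, hpair.1⟩, j, k, hjk, rfl, hpair.2⟩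

include hP in
theorem colour_map_rotationMix {c : Flag P → Bool} (hc : IsFlagColouring c)
    (g : rotationMix Φ₀ T t) (Ψ : Flag P) : c (Flag.map g.1.1 Ψ) = c Ψ := by
  have hle : rotationMix Φ₀ T t ≤
      (rotationGroup Φ₀).comap (MonoidHom.fst (P ≃o P) T.aut) := by
    rw [rotationMix, Subgroup.closure_le]
    rintro g ⟨i, hg, -⟩
    exact hP.mem_rotationGroup_of_isAbstractRotation hc hg
  exact (hP.mem_rotationGroup_iff hc).1 (hle g.2) Ψ

end

variable (hP : IsPolytope (n + 1) P) {T : Maniplex.{u} (n + 1)} {Φ₀ : Flag P} {t : T.Flags}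

theorem exists_rotationMixHom_apply (hrotary : IsRotaryPolytope P)
    (hT : ∀ i : Fin n, ∃ δ, T.IsAbstractRotation t (i + 1) δ) (i : Fin n) :
    ∃ g, (rotationMixHom hP g).1 (mixBase hP.flagManiplex T (Φ₀, t)) =
      (mix hP.flagManiplex T (Φ₀, t)).r i.castSucc
        ((mix hP.flagManiplex T (Φ₀, t)).r i.succ (mixBase hP.flagManiplex T (Φ₀, t))) := by
  obtain ⟨γ, hγ⟩ := hP.exists_abstractRotation hrotary Φ₀ (a := i.castSucc) (b := i.succ) (by simp)
  obtain ⟨δ, hδ⟩ := hT i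
  refine ⟨⟨(γ, δ), Subgroup.subset_closure ⟨_, hγ, hδ⟩⟩, ?_⟩
  obtain ⟨j', k', hj', hk', hγ⟩ := hP.isAbstractRotation_iff.1 hγ
  obtain ⟨j, k, hj, hk, hδ⟩ := hδ
  obtain rfl : j' = i.castSucc := Fin.ext (by simpa using hj')
  obtain rfl : k' = i.succ := Fin.ext hk'
  obtain rfl : j = i.castSucc := Fin.ext (by simpa using hj)
  obtain rfl : k = i.succ := Fin.ext hk
  exact Subtype.ext (Prod.ext hγ hδ)

variable {c : Flag P → Bool} (hc : IsFlagColouring c)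
  (hmix : (mix hP.flagManiplex T (Φ₀, t)).IsPolytopal)
include hc hmix

theorem isRotaryPolytope_mix (hrotary : IsRotaryPolytope P)
    (hT : ∀ i : Fin n, ∃ δ, T.IsAbstractRotation t (i + 1) δ) :
    IsRotaryPolytope (mix hP.flagManiplex T (Φ₀, t)).Poset := by
  refine hmix.isRotaryPolytope (c := fun w : MixFlags hP.flagManiplex T (Φ₀, t) => c w.1.1)
    (fun i w => hP.isFlagColouring_iff.1 hc i w.1.1) (Γ := (rotationMixHom hP).range)
    ?_ (x := mixBase _ _ _) fun i => ?_
  · rintro _ ⟨g, rfl⟩ w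
    exact colour_map_rotationMix hP hc g _
  · obtain ⟨g, hg⟩ := exists_rotationMixHom_apply hP hrotary hT i
    exact ⟨_, ⟨g, rfl⟩, hg⟩

theorem exists_rotationGroup_mix_mulEquiv (hrotary : IsRotaryPolytope P)
    (hT : ∀ i : Fin n, ∃ δ, T.IsAbstractRotation t (i + 1) δ) :
    ∃ f : rotationGroup (flagOf (mixBase hP.flagManiplex T (Φ₀, t))) ≃* rotationMix Φ₀ T t,
      ∀ i γ, IsAbstractRotation (flagOf (mixBase hP.flagManiplex T (Φ₀, t))) i γ.1 →
        IsAbstractRotation Φ₀ i (f γ).1.1 ∧ T.IsAbstractRotation t i (f γ).1.2 := by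
  obtain ⟨f, hf⟩ := hmix.exists_rotationGroup_mulEquiv
    (c := fun w : MixFlags hP.flagManiplex T (Φ₀, t) => c w.1.1)
    (fun i w => hP.isFlagColouring_iff.1 hc i w.1.1) (rotationMixHom_injective hP)
    (fun g _ => colour_map_rotationMix hP hc g _) (exists_rotationMixHom_apply hP hrotary hT)
  refine ⟨f, fun i γ hγ => ?_⟩
  obtain ⟨j, k, hj, rfl, hγΦ⟩ := hmix.isPolytope.isAbstractRotation_iff.1 hγ
  rw [hf, hmix.adj_flagOf, hmix.adj_flagOf] at hγΦ
  exact isAbstractRotation_of_rotationMixHom hP hj (hmix.flagOf_injective hγΦ)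

end RotationMix

/-! ### The Schläfli type of a mix -/

theorem minimalPeriod_of_semiconj {X Y : Type*} {f : X → Y} {g : X → X} {g' : Y → Y}
    (h : Function.Semiconj f g g') {x : X} (hinj : ∀ m, f (g^[m] x) = f x → g^[m] x = x) :
    Function.minimalPeriod g' (f x) = Function.minimalPeriod g x :=
  Function.minimalPeriod_eq_minimalPeriod_iff.2 fun m => by
    rw [Function.IsPeriodicPt, Function.IsFixedPt, ← (h.iterate_right m).eq]
    exact ⟨hinj m, congrArg f⟩

theorem card_zmod_lcm (a : ℕ) {b : ℕ} (hb : b ≠ 0) :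
    ENat.card (ZMod (Nat.lcm a b)) = lcmTop (ENat.card (ZMod a)) b := by
  rcases eq_or_ne a 0 with rfl | ha
  · rw [Nat.lcm_zero_left]
    simp [lcmTop, ZMod]
  · have := NeZero.mk ha
    have := NeZero.mk (Nat.lcm_ne_zero ha hb)
    rw [ENat.card_eq_coe_fintype_card, ENat.card_eq_coe_fintype_card, ZMod.card, ZMod.card,
      lcmTop, if_neg (ENat.natCast_ne_top a), ENat.toNat_natCast]

theorem Linked.iterate {ι X : Type*} {r : ι → Equiv.Perm X} {I : Set ι} {g : X → X}
    (hg : ∀ x, Linked r I x (g x)) (m : ℕ) (x : X) : Linked r I x (g^[m] x) := by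
  induction m with
  | zero => exact Linked.refl x
  | succ m ih =>
    rw [Function.iterate_succ_apply']
    exact ih.trans (hg _)

theorem Maniplex.minimalPeriod_mix {n : ℕ} {M₁ M₂ : Maniplex.{u} n} {a : M₁.Flags × M₂.Flags}
    (i j : Fin n) (w : MixFlags M₁ M₂ a) :
    Function.minimalPeriod (fun z => (mix M₁ M₂ a).r i ((mix M₁ M₂ a).r j z)) w =
      Nat.lcm (Function.minimalPeriod (fun z => M₁.r i (M₁.r j z)) w.1.1)
        (Function.minimalPeriod (fun z => M₂.r i (M₂.r j z)) w.1.2) := by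
  rw [← Function.minimalPeriod_prodMap]
  exact (minimalPeriod_of_semiconj (X := MixFlags M₁ M₂ a) (f := Subtype.val)
    (g := fun z => (mix M₁ M₂ a).r i ((mix M₁ M₂ a).r j z)) (fun _ => rfl)
    fun _ h => Subtype.ext h).symm

theorem Maniplex.IsPolytopal.minimalPeriod_flagOf {n : ℕ} {M : Maniplex.{u} n}
    (hM : M.IsPolytopal) (i j : Fin n) (x : M.Flags) :
    Function.minimalPeriod (fun Ψ => hM.isPolytope.adj i (hM.isPolytope.adj j Ψ)) (flagOf x) =
      Function.minimalPeriod (fun y => M.r i (M.r j y)) x :=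
  minimalPeriod_of_semiconj (fun y => by simp only [hM.adj_flagOf])
    fun _ h => hM.flagOf_injective h

theorem hasSchlafliType_mix {n : ℕ} {P : Type u} [PartialOrder P] [BoundedOrder P]
    (hP : IsPolytope (n + 1) P) {c : Flag P → Bool} (hc : IsFlagColouring c)
    {T : Maniplex.{u} (n + 1)} {a : hP.flagManiplex.Flags × T.Flags}
    (hmix : (Maniplex.mix hP.flagManiplex T a).IsPolytopal)
    (hinj : ∀ x y : Maniplex.MixFlags hP.flagManiplex T a,
      Linked (Maniplex.mix hP.flagManiplex T a).r {Fin.last n}ᶜ x y → x.1.1 = y.1.1 → x = y)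
    {p : ℕ → ℕ∞} {q : ℕ∞} (hPtype : HasSchlafliType (n + 1) P (Function.update p n q))
    {m : ℕ} (hm : m ≠ 0) (hT : ∀ l : Fin n, (l : ℕ) + 1 = n → ∀ z,
      Function.minimalPeriod (fun w => T.r l.castSucc (T.r (Fin.last n) w)) z = m) :
    HasSchlafliType (n + 1) (Maniplex.mix hP.flagManiplex T a).Poset
      (Function.update p n (lcmTop q m)) := by
  obtain ⟨_, hc', -⟩ := hmix.exists_isFlagColouring
    (c := fun w : Maniplex.MixFlags hP.flagManiplex T a => c w.1.1)
    fun i w => hP.isFlagColouring_iff.1 hc i w.1.1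
  rw [hP.hasSchlafliType_iff hc] at hPtype
  refine (hmix.isPolytope.hasSchlafliType_iff hc').2 fun l Ψ => ?_
  obtain ⟨w, rfl⟩ := Maniplex.flagOf_surjective Ψ
  rw [hmix.minimalPeriod_flagOf]
  by_cases hl : (l : ℕ) + 1 = n
  · have hlast : l.succ = Fin.last n := Fin.ext hl
    have hperiod := hPtype l w.1.1
    rw [hl, Function.update_self] at hperiod ⊢
    rw [Maniplex.minimalPeriod_mix l.castSucc l.succ w, hlast, hT l hl, card_zmod_lcm _ hm, ← hlast]
    exact congrArg (lcmTop · m) hperiod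
  · have hstep : ∀ i : Fin (n + 1), (i : ℕ) ≠ n → ∀ z,
        Linked (Maniplex.mix hP.flagManiplex T a).r {Fin.last n}ᶜ z
          ((Maniplex.mix hP.flagManiplex T a).r i z) := fun i hi z =>
      (Linked.refl z).tail fun h => hi (congrArg Fin.val h)
    rw [Function.update_of_ne hl, ← Function.update_of_ne hl q p, ← hPtype l w.1.1]
    refine congrArg (fun k => ENat.card (ZMod k)) (minimalPeriod_of_semiconj
      (f := fun z : Maniplex.MixFlags hP.flagManiplex T a => z.1.1) (fun _ => rfl)
      fun k hk => ?_).symm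
    exact (hinj _ _ (Linked.iterate (fun z => (hstep _ (by simpa using hl) z).trans
      (hstep _ (by grind) _)) k w) hk.symm).symm

theorem mix_twoS_injOn_facet {n : ℕ} {K P : Type u} [PartialOrder K] [PartialOrder P]
    [BoundedOrder P] (hP : IsPolytope (n + 1) P) (hPext : IsExtension n K P) {R : Maniplex.{u} n}
    (hKR : PolytopeCovers K R) (hR : R.IsRegular) {x₀ : R.Flags} {s : ℕ}
    {a : hP.flagManiplex.Flags × (R.twoS x₀ s).Flags}
    (x y : Maniplex.MixFlags hP.flagManiplex (R.twoS x₀ s) a)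
    (hxy : Linked (Maniplex.mix hP.flagManiplex (R.twoS x₀ s) a).r {Fin.last n}ᶜ x y)
    (h : x.1.1 = y.1.1) : x = y := by
  obtain ⟨⟨Φ, z, v, d⟩, hx⟩ := x
  obtain ⟨ψ, hψΦ, hψ⟩ := exists_facet_cover hP hPext hKR hR Φ z
  suffices hlinked : hP.face y.1.1 (Fin.last n).succ.castSucc =
      hP.face Φ (Fin.last n).succ.castSucc ∧ y.1.2 = ((ψ y.1.1, v, d) : R.TwoSFlags s) by
    refine Subtype.ext (Prod.ext h ?_)
    rw [hlinked.2, ← h, hψΦ]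
  clear h
  induction hxy using Linked.induction with
  | refl => exact ⟨rfl, by rw [hψΦ]⟩
  | tail y _ i hi ih =>
    obtain ⟨j, rfl⟩ : ∃ j : Fin n, i = j.castSucc :=
      ⟨i.castPred hi, (Fin.castSucc_castPred i hi).symm⟩
    refine ⟨(hP.face_adj (by grind)).trans ih.1, ?_⟩
    change (R.twoS x₀ s).r j.castSucc y.1.2 =
      ((ψ (hP.adj j.castSucc y.1.1), v, d) : R.TwoSFlags s)
    rw [ih.2, Maniplex.twoS_r_castSucc, hψ _ ih.1]

theorem theorem4p3 (n : ℕ) (p : ℕ → ℕ∞) (q : ℕ∞)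
    (K : Type u) [PartialOrder K] [BoundedOrder K]
    (hK : IsPolytope n K) (hKchiral : IsChiralPolytope K) (hKtype : HasSchlafliType n K p)
    (R : Maniplex.{u} n) (hKR : PolytopeCovers K R) (hRreg : R.IsRegular)
    (hRfacets : Nontrivial R.Facet)
    (P : Type u) [PartialOrder P] [BoundedOrder P]
    (hP : IsPolytope (n + 1) P) (hPchiral : IsChiralPolytope P) (hPext : IsExtension n K P)
    (hPtype : HasSchlafliType (n + 1) P (Function.update p n q))
    (Φ₀ : Flag P) (x₀ : R.Flags) (s : ℕ) (hs : 1 ≤ s) :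
    ∃ (Q : Type u) (_ : PartialOrder Q) (_ : BoundedOrder Q),
      IsPolytope (n + 1) Q ∧ IsChiralPolytope Q ∧ IsExtension n K Q ∧
      HasSchlafliType (n + 1) Q (Function.update p n (lcmTop q (2 * s))) ∧
      ∃ (Ψ₀ : Flag Q)
        (f : rotationGroup Ψ₀ ≃* rotationMix Φ₀ (R.twoS x₀ s) (R.twoSBase x₀ s)),
        ∀ (i : ℕ) (γ : rotationGroup Ψ₀), IsAbstractRotation Ψ₀ i (γ : Q ≃o Q) →
          IsAbstractRotation Φ₀ i (f γ : (P ≃o P) × (R.twoS x₀ s).aut).1 ∧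
          (R.twoS x₀ s).IsAbstractRotation (R.twoSBase x₀ s) i
            (f γ : (P ≃o P) × (R.twoS x₀ s).aut).2 := by
  obtain ⟨c, hc⟩ := hPchiral.exists_colouring
  let a : hP.flagManiplex.Flags × (R.twoS x₀ s).Flags := (Φ₀, R.twoSBase x₀ s)
  let w₀ := hP.flagManiplex.mixBase (R.twoS x₀ s) a
  have hinj := mix_twoS_injOn_facet hP hPext hKR hRreg (a := a)
  have hmix : (hP.flagManiplex.mix (R.twoS x₀ s) a).IsPolytopal :=
    hP.isPolytopal_flagManiplex.of_cover (fun w => w.1.1) (fun _ _ => rfl) hinj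
  have hext : IsExtension n K (hP.flagManiplex.mix (R.twoS x₀ s) a).Poset :=
    Maniplex.isExtension_poset hP (f := fun w : Maniplex.MixFlags _ _ a => w.1.1)
      (fun _ _ => rfl) hinj hPext
  have hrot : ∀ i : Fin n, ∃ δ, (R.twoS x₀ s).IsAbstractRotation (R.twoSBase x₀ s) (i + 1) δ :=
    fun i => Maniplex.exists_twoS_abstractRotation s x₀ hRreg (by omega) (by omega)
  have hchiral : IsChiralPolytope (hP.flagManiplex.mix (R.twoS x₀ s) a).Poset :=
    ⟨isRotaryPolytope_mix hP hc hmix hPchiral.1 hrot,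
      fun hreg => hKchiral.2 (hext.isRegularPolytope hmix.isPolytope hreg)⟩
  have htype := hasSchlafliType_mix hP hc hmix hinj hPtype (m := 2 * s) (by omega)
    fun _ hl => Maniplex.minimalPeriod_twoS s x₀ hRreg hRfacets hl
  exact ⟨_, _, _, hmix.isPolytope, hchiral, hext, htype, Maniplex.flagOf w₀,
    exists_rotationGroup_mix_mulEquiv hP hc hmix hPchiral.1 hrot⟩
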